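/- Let $\Omega_x\subset\mathbb R^{d}$ ($d\ge 1$) be a bounded domain (nonempty, open, connected) with smooth boundary, such that either $0\in\partial\Omega_x$, or $d\ge 3$ and $0\in\Omega_x$. Put $\mathsf H=d^2/4$ if $0\in\partial\Omega_x$, and $\mathsf H=(d-2)^2/4$ if $d\ge3$ and $0\in\Omega_x$. Let $\nu>0$, and let $q:\overline{\Omega_x}\to\mathbb R$ be continuous with $q(0)=0$ and $q(x)\neq0$ for every $x\in\overline{\Omega_x}\setminus\{0\}$. For $\xi>0$ let $G_\xi$ be the operator on $L^2(\Omega_x)$ $$G_\xi=-\Delta+\xi^2q(x)^2+\frac{\nu^2-\mathsf H}{|x|^2},\qquad D(G_\xi)=\{f\in H^1_0(\Omega_x):\ G_\xi f\in L^2(\Omega_x)\},$$ where $G_\xi f$ is understood in the sense of distributions on $\Omega_x$. For every $\xi>0$ let $\lambda_\xi$ be an eigenvalue of $G_\xi$ and $u_\xi$ an associated real eigenfunction with $\|u_\xi\|_{L^2(\Omega_x)}=1$, and assume that $\lambda_\xi=o(\xi^2)$ as $\xi\to+\infty$. For $\delta>0$ let $F_\delta=\{x\in\Omega_x:\ q(x)^2\le\delta\}$,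 and for $x,x'\in\Omega_x$ let $$d_{\mathrm{agm},\delta}(x,x')=\inf_c\int_0^1\big(q(c(t))^2-\delta\big)_+^{1/2}\,|c'(t)|\,dt,$$ where the infimum is over the piecewise $C^1$ paths $c:[0,1]\to\Omega_x$ with $c(0)=x$ and $c(1)=x'$; for $A,B\subset\Omega_x$ let $d_{\mathrm{agm},\delta}(A,B)=\inf_{x\in A,\,x'\in B}d_{\mathrm{agm},\delta}(x,x')$. Let $\omega_x\subset\Omega_x$ be a measurable set with $0\notin\overline{\omega_x}$. Then there exists $\delta_0>0$ such that for every $\delta\in(0,\delta_0)$ one has $F_\delta\cap\overline{\omega_x}=\emptyset$, and there exist $\xi_0>0$ and $C>0$ such that, for every $\xi\ge\xi_0$, $$\int_{\omega_x}u_\xi(x)^2\,dx\le C\,e^{-2\xi(1-\delta)\,d_{\mathrm{agm},\delta}(\omega_x,F_\delta)}.$$ -/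

import Mathlib

open Set Filter Topology MeasureTheory
open scoped ContDiff

namespace Grushin

noncomputable section

/-- Bounded domains (nonempty, open, connected, bounded sets) of `ℝᵈ` with smooth boundary: near
each boundary point `p`, the set is the sublevel set `{ρ < 0}` of a smooth function `ρ` with
nonvanishing differential at `p`. -/
structure IsSmoothBoundedDomain {d : ℕ} (Ω : Set (EuclideanSpace ℝ (Fin d))) : Prop where
  isOpen : IsOpen Ω
  isConnected : IsConnected Ω
  isBounded : Bornology.IsBounded Ω
  smooth_boundary : ∀ p ∈ frontier Ω, ∃ U : Set (EuclideanSpace ℝ (Fin d)),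
    ∃ ρ : EuclideanSpace ℝ (Fin d) → ℝ, IsOpen U ∧ p ∈ U ∧ ContDiffOn ℝ ∞ ρ U ∧
      fderiv ℝ ρ p ≠ 0 ∧ Ω ∩ U = {x ∈ U | ρ x < 0}

open Classical in
/-- The Hardy constant: `d² / 4` if `0 ∈ ∂Ω`, and `(d - 2)² / 4` otherwise
(used when `d ≥ 3` and `0 ∈ Ω`). -/
def hardyConst {d : ℕ} (Ω : Set (EuclideanSpace ℝ (Fin d))) : ℝ :=
  if (0 : EuclideanSpace ℝ (Fin d)) ∈ frontier Ω then (d : ℝ) ^ 2 / 4 else ((d : ℝ) - 2) ^ 2 / 4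

/-- Test functions: `φ ∈ C_c^∞(Ω)`. -/
structure IsTestFunction {d : ℕ} (Ω : Set (EuclideanSpace ℝ (Fin d)))
    (φ : EuclideanSpace ℝ (Fin d) → ℝ) : Prop where
  contDiff : ContDiff ℝ ∞ φ
  hasCompactSupport : HasCompactSupport φ
  tsupport_subset : tsupport φ ⊆ Ω

/-- `f ∈ H_0^1(Ω)` with (weak) gradient `g`: the pair `(f, g)` is in the closure, in
`L²(Ω) × L²(Ω; ℝᵈ)`, of the pairs `(φ, ∇φ)` with `φ ∈ C_c^∞(Ω)`. -/
structure IsH10WithGradient {d : ℕ} (Ω : Set (EuclideanSpace ℝ (Fin d)))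
    (f : EuclideanSpace ℝ (Fin d) → ℝ)
    (g : EuclideanSpace ℝ (Fin d) → EuclideanSpace ℝ (Fin d)) : Prop where
  memLp : MemLp f 2 (volume.restrict Ω)
  memLp_gradient : MemLp g 2 (volume.restrict Ω)
  exists_approx : ∃ φ : ℕ → EuclideanSpace ℝ (Fin d) → ℝ,
    (∀ n, IsTestFunction Ω (φ n)) ∧
    Tendsto (fun n => eLpNorm (fun x => φ n x - f x) 2 (volume.restrict Ω)) atTop (𝓝 0) ∧
    Tendsto (fun n => eLpNorm (fun x => gradient (φ n) x - g x) 2 (volume.restrict Ω))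
      atTop (𝓝 0)

/-- The graph of the operator `G_ξ = -Δ + ξ² q² + (ν² - H) / |x|²` on `L²(Ω)` with domain
`{u ∈ H_0^1(Ω) : G_ξ u ∈ L²(Ω)}`: `u` is in the domain and `G_ξ u = f`, where `G_ξ u` is taken in
the sense of distributions on `Ω`. -/
def IsGrushinImage {d : ℕ} (Ω : Set (EuclideanSpace ℝ (Fin d)))
    (q : EuclideanSpace ℝ (Fin d) → ℝ) (ν ξ : ℝ) (u f : EuclideanSpace ℝ (Fin d) → ℝ) : Prop :=
  MemLp f 2 (volume.restrict Ω) ∧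
  ∃ g : EuclideanSpace ℝ (Fin d) → EuclideanSpace ℝ (Fin d), IsH10WithGradient Ω u g ∧
    ∀ φ : EuclideanSpace ℝ (Fin d) → ℝ, IsTestFunction Ω φ →
      ∫ x in Ω, (inner ℝ (g x) (gradient φ x)
        + (ξ ^ 2 * q x ^ 2 + (ν ^ 2 - hardyConst Ω) / ‖x‖ ^ 2) * u x * φ x) =
      ∫ x in Ω, f x * φ x

/-- `u` is an eigenfunction of `G_ξ` for the eigenvalue `lam`, with `‖u‖_{L²(Ω)} = 1`. -/
def IsNormalizedEigenfunction {d : ℕ} (Ω : Set (EuclideanSpace ℝ (Fin d)))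
    (q : EuclideanSpace ℝ (Fin d) → ℝ) (ν ξ lam : ℝ) (u : EuclideanSpace ℝ (Fin d) → ℝ) : Prop :=
  IsGrushinImage Ω q ν ξ u (fun x => lam * u x) ∧ ∫ x in Ω, u x ^ 2 = 1

/-- `c` restricted to `[0, 1]` is a piecewise `C¹` path in `Ω` from `x` to `x'`. -/
structure IsPiecewiseC1Path {d : ℕ} (Ω : Set (EuclideanSpace ℝ (Fin d)))
    (x x' : EuclideanSpace ℝ (Fin d)) (c : ℝ → EuclideanSpace ℝ (Fin d)) : Prop where
  continuousOn : ContinuousOn c (Icc 0 1)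
  source : c 0 = x
  target : c 1 = x'
  mapsTo : MapsTo c (Icc 0 1) Ω
  piecewise : ∃ (n : ℕ) (t : ℕ → ℝ), Monotone t ∧ t 0 = 0 ∧ t n = 1 ∧
    ∀ i < n, ContDiffOn ℝ 1 c (Icc (t i) (t (i + 1)))

/-- The length of `c` for the degenerate metric `(q² - E)₊ dx²`. -/
def agmonLength {d : ℕ} (q : EuclideanSpace ℝ (Fin d) → ℝ) (E : ℝ)
    (c : ℝ → EuclideanSpace ℝ (Fin d)) : ℝ :=
  ∫ t in (0 : ℝ)..1, Real.sqrt (max (q (c t) ^ 2 - E) 0) * ‖deriv c t‖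

/-- The Agmon distance `d_{agm,E}(x, x')` in `Ω`. -/
def agmonDist {d : ℕ} (Ω : Set (EuclideanSpace ℝ (Fin d))) (q : EuclideanSpace ℝ (Fin d) → ℝ)
    (E : ℝ) (x x' : EuclideanSpace ℝ (Fin d)) : ℝ :=
  sInf {l | ∃ c, IsPiecewiseC1Path Ω x x' c ∧ l = agmonLength q E c}

/-- The Agmon distance `d_{agm,E}(A, B)` between two sets. -/
def agmonSetDist {d : ℕ} (Ω : Set (EuclideanSpace ℝ (Fin d))) (q : EuclideanSpace ℝ (Fin d) → ℝ)
    (E : ℝ) (A B : Set (EuclideanSpace ℝ (Fin d))) : ℝ :=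
  sInf {l | ∃ x ∈ A, ∃ x' ∈ B, l = agmonDist Ω q E x x'}

/-- `F_δ = {x ∈ Ω : q(x)² ≤ δ}`. -/
def wellSet {d : ℕ} (Ω : Set (EuclideanSpace ℝ (Fin d))) (q : EuclideanSpace ℝ (Fin d) → ℝ)
    (δ : ℝ) : Set (EuclideanSpace ℝ (Fin d)) :=
  {x ∈ Ω | q x ^ 2 ≤ δ}

end

end Grushin

/-! This is an Agmon estimate in which the inverse-square term is absorbed by a Hardy inequality.
Since `ν > 0`, the number `κ = H - ν²` lies strictly below the Hardy constant, so `κ ∫ w²/|x|² ≤ ∫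
|∇w|² + C ∫ w²` on test functions (`hardy`). Thus `-Δ - κ/|x|²` is bounded below by `-C`, and only
`ξ² q²` has to be compared with the weight.

Let `T` be the Agmon distance from `S` to the well `F_δ`, and let `Ψ` be close to `ξ min(d(·, F_δ),
T)`, so that `|∇Ψ|² ≤ ξ² ((q² - δ)₊ + δ/2)`. Testing the eigenvalue equation against `e^{2Ψ} u` and
writing `w = e^Ψ u`, conjugation and Hardy give `∫ (ξ² q² - λ - |∇Ψ|² - C) w² ≤ 0`. Once `|λ| + |C|
≤ ξ² δ/4`, the bracket is at least `ξ² δ/4` off the well and at least `-ξ² δ` on it, where `Ψ ≤ 1`.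
As `Ψ ≥ ξ T - 1` on `S`, this bounds `∫_S u²` by `4 e⁴ e^{-2ξT}`, which is stronger than the claim.

Hardy inequalities come from vector fields: `|∇w + w F|² ≥ 0` and an integration by parts make `div
F - |F|²` an admissible weight. At an interior origin `F` is a regularised multiple of `x/|x|²`. At
a boundary origin it is `-∇h/h` for an explicit positive `h` vanishing on an exterior tangent
sphere.

Neither `u` nor the Agmon distance is smooth. The estimate is therefore run on test functions `φ_n →
u` in `H¹`, with weights `Ψ_n` mollified on the support of `φ_n` but with bounds independent of `n`.
By Hardy the quadratic form is continuous on `H¹₀` (`exists_form_bound`), so the equation holds for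
`φ_n` up to an error tending to `0`. -/

/-- The divergence of a vector field on `ℝᵈ`. -/
noncomputable def divergence {d : ℕ} (F : EuclideanSpace ℝ (Fin d) → EuclideanSpace ℝ (Fin d))
    (x : EuclideanSpace ℝ (Fin d)) : ℝ :=
  ∑ i, (fderiv ℝ F x (EuclideanSpace.single i 1)) i

/-! ### Divergence calculus and Hardy weights from vector fields. -/

section Divergence

variable {d : ℕ} {F G : EuclideanSpace ℝ (Fin d) → EuclideanSpace ℝ (Fin d)}
  {h w : EuclideanSpace ℝ (Fin d) → ℝ} {x : EuclideanSpace ℝ (Fin d)}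

theorem EuclideanSpace.sum_mul_apply_single (L : EuclideanSpace ℝ (Fin d) →L[ℝ] ℝ)
    (v : EuclideanSpace ℝ (Fin d)) : ∑ i, v i * L (EuclideanSpace.single i 1) = L v := by
  conv_rhs => rw [← (EuclideanSpace.basisFun (Fin d) ℝ).sum_repr v]
  simp [map_sum]

theorem divergence_add (hF : DifferentiableAt ℝ F x) (hG : DifferentiableAt ℝ G x) :
    divergence (fun y => F y + G y) x = divergence F x + divergence G x := by
  simp [divergence, fderiv_fun_add hF hG, Finset.sum_add_distrib]

theorem divergence_sub (hF : DifferentiableAt ℝ F x) (hG : DifferentiableAt ℝ G x) :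
    divergence (fun y => F y - G y) x = divergence F x - divergence G x := by
  simp [divergence, fderiv_fun_sub hF hG, Finset.sum_sub_distrib]

theorem divergence_smul (hh : DifferentiableAt ℝ h x) (hF : DifferentiableAt ℝ F x) :
    divergence (fun y => h y • F y) x = h x * divergence F x + fderiv ℝ h x (F x) := by
  simp only [divergence, fderiv_fun_smul hh hF, ← EuclideanSpace.sum_mul_apply_single _ (F x),
    Finset.mul_sum, ← Finset.sum_add_distrib]
  refine Finset.sum_congr rfl fun i _ => ?_
  simp [mul_comm]

theorem divergence_const_smul_sub (c : ℝ) (p : EuclideanSpace ℝ (Fin d)) :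
    divergence (fun y => c • y - p) x = c * d := by
  have : fderiv ℝ (fun y : EuclideanSpace ℝ (Fin d) => c • y - p) x =
      c • ContinuousLinearMap.id ℝ _ :=
    (((hasFDerivAt_id x).const_smul c).sub_const p).fderiv
  simp [divergence, this, mul_comm]

theorem Filter.EventuallyEq.divergence_eq (hFG : F =ᶠ[𝓝 x] G) :
    divergence F x = divergence G x := by
  simp only [divergence, hFG.fderiv_eq]

/-- Continuity of `f` is asked only on the support of `g`, because the Hardy fields are singular
elsewhere. -/
theorem Continuous.integrable_mul_of_continuousAt {f g : EuclideanSpace ℝ (Fin d) → ℝ}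
    (hg : Continuous g) (hc : HasCompactSupport g) (hf : ∀ x ∈ tsupport g, ContinuousAt f x) :
    Integrable fun x => f x * g x := by
  refine Continuous.integrable_of_hasCompactSupport ?_ hc.mul_left
  refine continuous_iff_continuousAt.2 fun x => ?_
  by_cases hx : x ∈ tsupport g
  · exact (hf x hx).mul hg.continuousAt
  · have : (fun x => f x * g x) =ᶠ[𝓝 x] fun _ => 0 := by
      filter_upwards [notMem_tsupport_iff_eventuallyEq.1 hx] with y hy
      simp [hy]
    exact (continuousAt_congr this).2 continuousAt_const

theorem continuous_gradient (hw : ContDiff ℝ 1 w) : Continuous (gradient w) :=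
  (InnerProductSpace.toDual ℝ _).symm.continuous.comp (hw.continuous_fderiv one_ne_zero)

theorem tsupport_gradient_subset : tsupport (gradient w) ⊆ tsupport w := by
  refine closure_minimal (fun x hx => ?_) (isClosed_tsupport w)
  refine support_fderiv_subset ℝ (f := w) fun h => hx ?_
  simp [gradient, h]

theorem hasCompactSupport_gradient (hc : HasCompactSupport w) :
    HasCompactSupport (gradient w) :=
  hc.mono' ((subset_tsupport _).trans tsupport_gradient_subset)

theorem ContDiffAt.continuousAt_divergence (hF : ContDiffAt ℝ 1 F x) :
    ContinuousAt (divergence F) x := by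
  have h1 : ContinuousAt (fderiv ℝ F) x := hF.continuousAt_fderiv one_ne_zero
  unfold divergence
  refine tendsto_finsetSum _ fun i _ => ?_
  exact (EuclideanSpace.proj (𝕜 := ℝ) i).continuous.continuousAt.comp (h1.clm_apply continuousAt_const)

/-- The vector field form of the Hardy inequality: `-|F|² + div F` is a Hardy weight. -/
theorem integral_divergence_sub_sq_mul_sq_le (hw : ContDiff ℝ 1 w) (hc : HasCompactSupport w)
    (hF : ∀ x ∈ tsupport w, ContDiffAt ℝ 1 F x) :
    Integrable (fun x => (divergence F x - ‖F x‖ ^ 2) * w x ^ 2) ∧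
    ∫ x, (divergence F x - ‖F x‖ ^ 2) * w x ^ 2 ≤ ∫ x, ‖gradient w x‖ ^ 2 := by
  have hsub : tsupport (fun x => w x ^ 2) ⊆ tsupport w := by
    refine closure_mono fun x hx hx' => hx (by simp [hx'])
  have hc2 : HasCompactSupport (fun x => w x ^ 2) := hc.mono' ((subset_tsupport _).trans hsub)
  have hw2 : ContDiff ℝ 1 (fun x => w x ^ 2) := hw.pow 2
  have hFi (i) : ∀ x ∈ tsupport w, ContDiffAt ℝ 1 (fun x => F x i) x := fun x hx =>
    (EuclideanSpace.proj (𝕜 := ℝ) i).contDiff.contDiffAt.comp x (hF x hx)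
  have hFd (i) : ∀ x ∈ tsupport w, ∀ v, fderiv ℝ (fun x => F x i) x v = (fderiv ℝ F x v) i := by
    intro x hx v
    have := ((EuclideanSpace.proj (𝕜 := ℝ) i).hasFDerivAt.comp x
      ((hF x hx).differentiableAt one_ne_zero).hasFDerivAt).fderiv
    change fderiv ℝ (EuclideanSpace.proj (𝕜 := ℝ) i ∘ F) x v = _
    rw [this]; rfl
  have hgc := continuous_gradient hw
  have hgs := hasCompactSupport_gradient hc
  have I0 : Integrable fun x => ‖gradient w x‖ ^ 2 :=
    (hgc.norm.pow 2).integrable_of_hasCompactSupport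
      (hgs.mono' ((subset_tsupport _).trans (closure_mono fun x hx hx' => hx (by simp [hx']))))
  have I1 : Integrable fun x => divergence F x * w x ^ 2 :=
    Continuous.integrable_mul_of_continuousAt hw2.continuous hc2 fun x hx =>
      (hF x (hsub hx)).continuousAt_divergence
  have I2 : Integrable fun x => ‖F x‖ ^ 2 * w x ^ 2 :=
    Continuous.integrable_mul_of_continuousAt hw2.continuous hc2 fun x hx =>
      ((hF x (hsub hx)).continuousAt.norm.pow 2)
  have hpart (i : Fin d) :
      Integrable (fun x => F x i * fderiv ℝ (fun x => w x ^ 2) x (EuclideanSpace.single i 1)) ∧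
      Integrable (fun x => (fderiv ℝ F x (EuclideanSpace.single i 1)) i * w x ^ 2) ∧
      ∫ x, F x i * fderiv ℝ (fun x => w x ^ 2) x (EuclideanSpace.single i 1) =
        - ∫ x, (fderiv ℝ F x (EuclideanSpace.single i 1)) i * w x ^ 2 := by
    have J1 : Integrable (fun x => F x i * fderiv ℝ (fun x => w x ^ 2) x
        (EuclideanSpace.single i 1)) := by
      refine Continuous.integrable_mul_of_continuousAt
        ((hw2.continuous_fderiv one_ne_zero).clm_apply continuous_const) (hc2.fderiv_apply ℝ _)
        fun x hx => (hFi i x (hsub ?_)).continuousAt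
      exact tsupport_fderiv_apply_subset ℝ _ hx
    have J2' : Integrable (fun x => (fderiv ℝ F x (EuclideanSpace.single i 1)) i * w x ^ 2) := by
      refine Continuous.integrable_mul_of_continuousAt hw2.continuous hc2 fun x hx => ?_
      exact (EuclideanSpace.proj (𝕜 := ℝ) i).continuous.continuousAt.comp
        (((hF x (hsub hx)).continuousAt_fderiv one_ne_zero).clm_apply continuousAt_const)
    have e : (fun x => fderiv ℝ (fun x => F x i) x (EuclideanSpace.single i 1) * w x ^ 2) =
        fun x => (fderiv ℝ F x (EuclideanSpace.single i 1)) i * w x ^ 2 := by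
      funext x
      by_cases hx : x ∈ tsupport w
      · rw [hFd i x hx]
      · simp [image_eq_zero_of_notMem_tsupport hx]
    refine ⟨J1, J2', ?_⟩
    rw [← e]
    refine integral_bilinear_fderiv_right_eq_neg_left_of_integrable
      (B := ContinuousLinearMap.mul ℝ ℝ) (f := fun x => F x i) (g := fun x => w x ^ 2)
      (v := EuclideanSpace.single i 1) (by simpa [e] using J2') J1 ?_ ?_ ?_
    · exact Continuous.integrable_mul_of_continuousAt hw2.continuous hc2 fun x hx =>
        (hFi i x (hsub hx)).continuousAt
    · exact fun x hx => (hFi i x (hsub hx)).differentiableAt one_ne_zero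
    · exact fun x _ => hw2.differentiable one_ne_zero x
  have hsum : ∀ x, ∑ i, F x i * fderiv ℝ (fun x => w x ^ 2) x (EuclideanSpace.single i 1) =
      2 * w x * inner ℝ (gradient w x) (F x) := by
    intro x
    rw [EuclideanSpace.sum_mul_apply_single, inner_gradient_left]
    rw [fderiv_fun_pow 2 (hw.differentiable one_ne_zero x)]
    simp
  have I3 : Integrable fun x => 2 * w x * inner ℝ (gradient w x) (F x) := by
    simp_rw [← hsum]
    exact integrable_finsetSum _ fun i _ => (hpart i).1
  have E3 : ∫ x, 2 * w x * inner ℝ (gradient w x) (F x) = - ∫ x, divergence F x * w x ^ 2 := by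
    simp_rw [← hsum, divergence, Finset.sum_mul]
    rw [integral_finsetSum _ fun i _ => (hpart i).1, integral_finsetSum _ fun i _ => (hpart i).2.1,
      ← Finset.sum_neg_distrib]
    exact Finset.sum_congr rfl fun i _ => (hpart i).2.2
  -- Expanding this square gives the inequality: its cross term is `F · ∇(w²)`, which integrates to
  -- `-∫ (div F) w²`.
  have hnn : 0 ≤ ∫ x, ‖gradient w x + w x • F x‖ ^ 2 := integral_nonneg fun x => by positivity
  have hexp : ∀ x, ‖gradient w x + w x • F x‖ ^ 2 =
      ‖gradient w x‖ ^ 2 + 2 * w x * inner ℝ (gradient w x) (F x) + ‖F x‖ ^ 2 * w x ^ 2 := by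
    intro x
    rw [norm_add_sq_real, inner_smul_right, norm_smul, mul_pow, Real.norm_eq_abs, sq_abs]
    ring
  simp_rw [hexp] at hnn
  rw [integral_add (by exact I0.add I3) I2, integral_add I0 I3, E3] at hnn
  simp_rw [sub_mul]
  refine ⟨I1.sub I2, ?_⟩
  rw [integral_sub I1 I2]
  linarith

end Divergence

/-! ### The Hardy field for an origin on the boundary. -/

section BoundaryField

variable {d : ℕ}

/-- Minus the logarithmic gradient of
`⟪x, x - p⟫ / (‖x‖ ‖x - p‖) ^ (d / 2)`, a positive function outside the ball of diameter `[0, p]`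
which vanishes on the sphere. -/
noncomputable def exteriorBallField (p x : EuclideanSpace ℝ (Fin d)) :
    EuclideanSpace ℝ (Fin d) :=
  ((d : ℝ) / 2 * (‖x‖ ^ 2)⁻¹) • ((1 : ℝ) • x - 0) +
    ((d : ℝ) / 2 * (‖x - p‖ ^ 2)⁻¹) • ((1 : ℝ) • x - p) -
    (inner ℝ x (x - p))⁻¹ • ((2 : ℝ) • x - p)

variable {p x : EuclideanSpace ℝ (Fin d)}

theorem contDiffAt_exteriorBallField {n : WithTop ℕ∞} (hx : x ≠ 0) (hxp : x ≠ p)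
    (hQ : inner ℝ x (x - p) ≠ 0) : ContDiffAt ℝ n (exteriorBallField p) x := by
  have h1 : ‖x‖ ^ 2 ≠ 0 := by simpa using hx
  have h2 : ‖x - p‖ ^ 2 ≠ 0 := by simpa [sub_eq_zero] using hxp
  have hL (c : ℝ) (q : EuclideanSpace ℝ (Fin d)) :
      ContDiffAt ℝ n (fun y : EuclideanSpace ℝ (Fin d) => c • y - q) x := by fun_prop
  have hA : ContDiffAt ℝ n (fun y : EuclideanSpace ℝ (Fin d) => ‖y‖ ^ 2) x :=
    (contDiff_norm_sq ℝ).contDiffAt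
  have hB : ContDiffAt ℝ n (fun y : EuclideanSpace ℝ (Fin d) => ‖y - p‖ ^ 2) x :=
    ContDiffAt.norm_sq ℝ (by fun_prop)
  have hC : ContDiffAt ℝ n (fun y : EuclideanSpace ℝ (Fin d) => inner ℝ y (y - p)) x :=
    ContDiffAt.inner ℝ contDiffAt_id (by fun_prop)
  exact ((((contDiffAt_const (c := (d : ℝ) / 2)).mul (hA.inv h1)).smul (hL 1 0)).add
    (((contDiffAt_const (c := (d : ℝ) / 2)).mul (hB.inv h2)).smul (hL 1 p))).sub
    ((hC.inv hQ).smul (hL 2 p))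

/-- For `F = -∇h/h` the left side is `-Δh/h`. The exponent `d/2` in `h` is the one for which this is
asymptotic to `(d²/4)/|x|²` at `0`. Everything reduces to a rational identity in `|x|²`, `|p|²` and
`⟪x, p⟫`. -/
theorem divergence_sub_sq_exteriorBallField (hx : x ≠ 0) (hxp : x ≠ p)
    (hQ : inner ℝ x (x - p) ≠ 0) :
    divergence (exteriorBallField p) x - ‖exteriorBallField p x‖ ^ 2 =
      (d : ℝ) ^ 2 / 4 * (‖p‖ ^ 2 / (‖x‖ ^ 2 * ‖x - p‖ ^ 2)) := by
  have h1 : ‖x‖ ^ 2 ≠ 0 := by simpa using hx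
  have h2 : ‖x - p‖ ^ 2 ≠ 0 := by simpa [sub_eq_zero] using hxp
  have D1 : HasFDerivAt (fun y : EuclideanSpace ℝ (Fin d) => (d : ℝ) / 2 * (‖y‖ ^ 2)⁻¹)
      (((d : ℝ) / 2) • (-(‖x‖ ^ 2) ^ 2)⁻¹ • (2 : ℝ) • innerSL ℝ x) x := by
    refine (((hasDerivAt_inv h1).comp_hasFDerivAt x
      (hasStrictFDerivAt_norm_sq x).hasFDerivAt).const_mul ((d : ℝ) / 2)).congr_fderiv ?_
    simp [inv_neg, two_smul]
  have D2 : HasFDerivAt (fun y : EuclideanSpace ℝ (Fin d) => (d : ℝ) / 2 * (‖y - p‖ ^ 2)⁻¹)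
      (((d : ℝ) / 2) • (-(‖x - p‖ ^ 2) ^ 2)⁻¹ • (2 : ℝ) • innerSL ℝ (x - p)) x := by
    have := (hasStrictFDerivAt_norm_sq (x - p)).hasFDerivAt.comp x ((hasFDerivAt_id x).sub_const p)
    refine (((hasDerivAt_inv h2).comp_hasFDerivAt x this).const_mul ((d : ℝ) / 2)).congr_fderiv ?_
    ext v; simp [inv_neg]
  have D3 : HasFDerivAt (fun y : EuclideanSpace ℝ (Fin d) => (inner ℝ y (y - p))⁻¹)
      ((-(inner ℝ x (x - p)) ^ 2)⁻¹ • innerSL ℝ ((2 : ℝ) • x - p)) x := by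
    have := (hasFDerivAt_id x).inner ℝ ((hasFDerivAt_id x).sub_const p)
    refine ((hasDerivAt_inv hQ).comp_hasFDerivAt x this).congr_fderiv ?_
    ext v
    simp only [_root_.smul_apply, innerSL_apply_apply, inv_neg, smul_eq_mul]
    simp [inner_sub_left, inner_sub_right, real_inner_comm, two_smul,
      inner_add_left]
    left; ring
  have L (c : ℝ) (q : EuclideanSpace ℝ (Fin d)) :
      DifferentiableAt ℝ (fun y : EuclideanSpace ℝ (Fin d) => c • y - q) x := by fun_prop
  rw [show exteriorBallField p = fun y => ((d : ℝ) / 2 * (‖y‖ ^ 2)⁻¹) • ((1 : ℝ) • y - 0) +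
      ((d : ℝ) / 2 * (‖y - p‖ ^ 2)⁻¹) • ((1 : ℝ) • y - p) -
      (inner ℝ y (y - p))⁻¹ • ((2 : ℝ) • y - p) from rfl,
    divergence_sub ((D1.differentiableAt.fun_smul (L 1 0)).fun_add
      (D2.differentiableAt.fun_smul (L 1 p))) (D3.differentiableAt.fun_smul (L 2 p)),
    divergence_add (D1.differentiableAt.fun_smul (L 1 0)) (D2.differentiableAt.fun_smul (L 1 p)),
    divergence_smul D1.differentiableAt (L _ _),
    divergence_smul D2.differentiableAt (L _ _), divergence_smul D3.differentiableAt (L _ _),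
    divergence_const_smul_sub, divergence_const_smul_sub, divergence_const_smul_sub,
    D1.fderiv, D2.fderiv, D3.fderiv]
  have hF : ((d : ℝ) / 2 * (‖x‖ ^ 2)⁻¹) • ((1 : ℝ) • x - 0) +
      ((d : ℝ) / 2 * (‖x - p‖ ^ 2)⁻¹) • ((1 : ℝ) • x - p) -
      (inner ℝ x (x - p))⁻¹ • ((2 : ℝ) • x - p) =
      ((d : ℝ) / 2 * (‖x‖ ^ 2)⁻¹ + (d : ℝ) / 2 * (‖x - p‖ ^ 2)⁻¹ - 2 * (inner ℝ x (x - p))⁻¹) • x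
      + ((inner ℝ x (x - p))⁻¹ - (d : ℝ) / 2 * (‖x - p‖ ^ 2)⁻¹) • p := by
    module
  have hn (α β : ℝ) : ‖α • x + β • p‖ ^ 2 =
      α ^ 2 * ‖x‖ ^ 2 + 2 * α * β * inner ℝ x p + β ^ 2 * ‖p‖ ^ 2 := by
    rw [norm_add_sq_real, norm_smul, norm_smul, inner_smul_left, inner_smul_right, mul_pow,
      mul_pow, Real.norm_eq_abs, Real.norm_eq_abs, sq_abs, sq_abs]
    simp; ring
  beta_reduce
  rw [hF, hn]
  have e2 : ‖x - p‖ ^ 2 = ‖x‖ ^ 2 - 2 * inner ℝ x p + ‖p‖ ^ 2 := norm_sub_sq_real x p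
  have e3 : inner ℝ x (x - p) = ‖x‖ ^ 2 - inner ℝ x p := by
    rw [inner_sub_right, real_inner_self_eq_norm_sq]
  simp only [_root_.smul_apply, innerSL_apply_apply, smul_eq_mul, one_smul, sub_zero,
    real_inner_self_eq_norm_sq]
  have e4 : ‖(2 : ℝ) • x - p‖ ^ 2 = 4 * ‖x‖ ^ 2 - 4 * inner ℝ x p + ‖p‖ ^ 2 := by
    rw [norm_sub_sq_real, norm_smul, inner_smul_left, mul_pow]; norm_num; ring
  rw [e4]
  rw [e3] at hQ ⊢
  rw [e2] at h2 ⊢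
  generalize ‖x‖ ^ 2 = a at *
  generalize ‖p‖ ^ 2 = b at *
  generalize inner ℝ x p = s at *
  field_simp
  ring

end BoundaryField

namespace Grushin

/-! ### Hardy inequalities on test functions. -/

section Hardy

variable {d : ℕ} {Ω : Set (EuclideanSpace ℝ (Fin d))}

theorem IsTestFunction.eq_zero {w : EuclideanSpace ℝ (Fin d) → ℝ} (hw : IsTestFunction Ω w)
    {x : EuclideanSpace ℝ (Fin d)} (hx : x ∉ Ω) : w x = 0 :=
  image_eq_zero_of_notMem_tsupport fun h => hx (hw.tsupport_subset h)

theorem IsTestFunction.contDiff_one {w : EuclideanSpace ℝ (Fin d) → ℝ}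
    (hw : IsTestFunction Ω w) : ContDiff ℝ 1 w := hw.contDiff.of_le (by simp)

theorem IsTestFunction.hasCompactSupport_sq {w : EuclideanSpace ℝ (Fin d) → ℝ}
    (hw : IsTestFunction Ω w) : HasCompactSupport fun x => w x ^ 2 :=
  hw.hasCompactSupport.comp_left (g := fun t : ℝ => t ^ 2) (by simp)

theorem IsTestFunction.integrable_sq {w : EuclideanSpace ℝ (Fin d) → ℝ}
    (hw : IsTestFunction Ω w) : Integrable fun x => w x ^ 2 :=
  (hw.contDiff.continuous.pow 2).integrable_of_hasCompactSupport hw.hasCompactSupport_sq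

/-- The exterior ball condition at the origin. -/
theorem IsSmoothBoundedDomain.exists_exterior_ball (hΩ : IsSmoothBoundedDomain Ω)
    (h0 : (0 : EuclideanSpace ℝ (Fin d)) ∈ frontier Ω) :
    ∃ p : EuclideanSpace ℝ (Fin d), p ≠ 0 ∧ ∃ R > 0, ∀ x ∈ Ω, ‖x‖ < R →
      ‖x‖ ^ 2 / 2 ≤ inner ℝ x (x - p) := by
  obtain ⟨U, ρ, hU, h0U, hρ, hρ0, hΩU⟩ := hΩ.smooth_boundary 0 h0
  have h0Ω : (0 : EuclideanSpace ℝ (Fin d)) ∉ Ω := by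
    rw [hΩ.isOpen.frontier_eq] at h0
    exact h0.2
  have hρnn : 0 ≤ ρ 0 := by
    by_contra! h
    exact h0Ω ((Set.ext_iff.1 hΩU 0).2 ⟨h0U, h⟩).1
  have hρa : ContDiffAt ℝ 2 ρ 0 := (hρ.contDiffAt (hU.mem_nhds h0U)).of_le
    (WithTop.coe_le_coe.2 (le_top : (2 : ℕ∞) ≤ ⊤))
  have hdd : DifferentiableAt ℝ (fderiv ℝ ρ) 0 :=
    (hρa.fderiv_right (m := 1) (by norm_num)).differentiableAt one_ne_zero
  obtain ⟨M, hM, hMb⟩ := hdd.isBigO_sub.exists_pos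
  obtain ⟨R, hR, hRb⟩ := Metric.eventually_nhds_iff_ball.1 (hMb.bound.and (hU.mem_nhds h0U))
  set n := gradient ρ 0 with hn
  have hn0 : n ≠ 0 := by
    rw [hn, gradient]
    simpa using hρ0
  -- With `ρ x < 0 ≤ ρ 0`, a second-order bound gives `dρ(0) x ≤ M |x|²`. Dividing the normal by
  -- `2M` uses up only half of `|x|²`, which keeps `⟪x, x - p⟫` positive on `Ω` near `0`.
  refine ⟨(2 * M)⁻¹ • n, by simp [hM.ne', hn0], R, hR, fun x hx hxR => ?_⟩
  have hxU : x ∈ U := (hRb x (by simpa using hxR)).2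
  have hneg : ρ x < 0 := ((Set.ext_iff.1 hΩU x).1 ⟨hx, hxU⟩).2
  have key := (convex_closedBall (0 : EuclideanSpace ℝ (Fin d)) ‖x‖).norm_image_sub_le_of_norm_hasFDerivWithin_le
    (f := fun y => ρ y - fderiv ℝ ρ 0 y) (f' := fun y => fderiv ℝ ρ y - fderiv ℝ ρ 0)
    (C := M * ‖x‖) (x := 0) (y := x) (fun y hy => ?_) (fun y hy => ?_) (by simp) (by simp)
  · have h1 : inner ℝ x n = fderiv ℝ ρ 0 x := by
      rw [real_inner_comm, hn, inner_gradient_left]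
    simp only [map_zero, sub_zero] at key
    have h2 := (abs_le.1 key).1
    rw [inner_sub_right, inner_smul_right, h1, real_inner_self_eq_norm_sq]
    have h3 : fderiv ℝ ρ 0 x ≤ M * ‖x‖ ^ 2 := by nlinarith
    have h4 : (2 * M)⁻¹ * fderiv ℝ ρ 0 x ≤ (2 * M)⁻¹ * (M * ‖x‖ ^ 2) := by gcongr
    have h5 : (2 * M)⁻¹ * (M * ‖x‖ ^ 2) = ‖x‖ ^ 2 / 2 := by field_simp
    linarith
  · have hyR : y ∈ Metric.ball (0 : EuclideanSpace ℝ (Fin d)) R := by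
      simp only [mem_closedBall_zero_iff, mem_ball_zero_iff] at hy ⊢; linarith
    have hyd : DifferentiableAt ℝ ρ y :=
      (hρ.contDiffAt (hU.mem_nhds (hRb y hyR).2)).differentiableAt (by simp)
    exact (hyd.hasFDerivAt.sub (fderiv ℝ ρ 0).hasFDerivAt).hasFDerivWithinAt
  · have hyR : y ∈ Metric.ball (0 : EuclideanSpace ℝ (Fin d)) R := by
      simp only [mem_closedBall_zero_iff, mem_ball_zero_iff] at hy ⊢; linarith
    refine (hRb y hyR).1.trans ?_
    simp only [mem_closedBall_zero_iff] at hy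
    simpa using mul_le_mul_of_nonneg_left hy hM.le

/-- The weight of the exterior ball field is `(d²/4)/|x|²` times a factor tending to `1` at `0`, so
the strict inequality on `κ` absorbs this factor in a small ball. Cutting the field off outside that
ball costs only a bounded term. -/
theorem hardy_of_mem_frontier (hΩ : IsSmoothBoundedDomain Ω)
    (h0 : (0 : EuclideanSpace ℝ (Fin d)) ∈ frontier Ω) {κ : ℝ} (hκ : κ < (d : ℝ) ^ 2 / 4) :
    ∃ C, ∀ w, IsTestFunction Ω w → Integrable (fun x => w x ^ 2 / ‖x‖ ^ 2) ∧
      κ * ∫ x, w x ^ 2 / ‖x‖ ^ 2 ≤ (∫ x, ‖gradient w x‖ ^ 2) + C * ∫ x, w x ^ 2 := by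
  obtain ⟨p, hp, R, hR, hQ⟩ := hΩ.exists_exterior_ball h0
  have h0Ω : (0 : EuclideanSpace ℝ (Fin d)) ∉ Ω := by
    rw [hΩ.isOpen.frontier_eq] at h0
    exact h0.2
  have hp' : 0 < ‖p‖ := norm_pos_iff.2 hp
  have hlim : ContinuousAt (fun x : EuclideanSpace ℝ (Fin d) =>
      (d : ℝ) ^ 2 / 4 * (‖p‖ ^ 2 / ‖x - p‖ ^ 2)) 0 := by
    refine continuousAt_const.mul (continuousAt_const.div (by fun_prop) ?_)
    simpa using hp
  have hev : ∀ᶠ x in 𝓝 (0 : EuclideanSpace ℝ (Fin d)),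
      κ < (d : ℝ) ^ 2 / 4 * (‖p‖ ^ 2 / ‖x - p‖ ^ 2) := by
    refine hlim.eventually (lt_mem_nhds ?_)
    simpa [hp'.ne'] using hκ
  obtain ⟨r₁, hr₁, hr₁b⟩ := Metric.eventually_nhds_iff_ball.1 hev
  obtain ⟨r, hr, hrm⟩ := exists_between (lt_min hr₁ (lt_min hR hp'))
  obtain ⟨hrr₁, hrR, hrp⟩ : r < r₁ ∧ r < R ∧ r < ‖p‖ := by simpa using hrm
  let χ : ContDiffBump (0 : EuclideanSpace ℝ (Fin d)) := ⟨r / 2, r, by positivity, by linarith⟩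
  set F := exteriorBallField p
  have hgood : ∀ x : EuclideanSpace ℝ (Fin d), x ≠ 0 → ‖x‖ ≤ r →
      ‖x‖ ^ 2 / 2 ≤ inner ℝ x (x - p) → x ≠ p ∧ inner ℝ x (x - p) ≠ 0 := by
    intro x hx hxr hxQ
    refine ⟨fun h => ?_, ?_⟩
    · rw [h] at hxr; linarith
    · have := norm_pos_iff.2 hx
      have : 0 < ‖x‖ ^ 2 / 2 := by positivity
      linarith
  -- `∇χ` lives on an annulus, and the closed exterior ball condition replaces `x ∈ Ω` there. The
  -- resulting set is compact and avoids all singularities of `F`.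
  obtain ⟨C₁, hC₁⟩ : ∃ C₁, ∀ x ∈ Metric.closedBall (0 : EuclideanSpace ℝ (Fin d)) r ∩
      {x | r / 2 ≤ ‖x‖ ∧ ‖x‖ ^ 2 / 2 ≤ inner ℝ x (x - p)}, ‖fderiv ℝ χ x (F x)‖ ≤ C₁ := by
    refine IsCompact.exists_bound_of_continuousOn ((isCompact_closedBall _ _).inter_right ?_) ?_
    · exact (isClosed_le continuous_const continuous_norm).inter
        (isClosed_le ((continuous_norm.pow 2).div_const 2)
          (continuous_id.inner (continuous_id.sub continuous_const)))
    · rintro x ⟨hxr, hxr2, hxQ⟩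
      have hx0 : x ≠ 0 := by
        rintro rfl
        rw [norm_zero] at hxr2; linarith
      obtain ⟨h1, h2⟩ := hgood x hx0 (by simpa using hxr) hxQ
      have hFc : ContinuousAt F x :=
        (contDiffAt_exteriorBallField (n := 1) hx0 h1 h2).continuousAt
      have hχc : ContinuousAt (fderiv ℝ χ) x :=
        (χ.contDiff (n := 1)).continuous_fderiv one_ne_zero |>.continuousAt
      exact (hχc.clm_apply hFc).continuousWithinAt
  have hC₁' : ∀ x ∈ Ω, ‖x‖ ≤ r → -|C₁| ≤ fderiv ℝ χ x (F x) := by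
    intro x hx hxr
    rcases le_or_gt (r / 2) ‖x‖ with h | h
    · have := hC₁ x ⟨by simpa using hxr, h, hQ x hx (by linarith)⟩
      have := (abs_le.1 this).1
      linarith [le_abs_self C₁]
    · have : χ =ᶠ[𝓝 x] fun _ => 1 := by
        filter_upwards [Metric.isOpen_ball.mem_nhds (show x ∈ Metric.ball 0 (r / 2) by
          simpa using h)] with y hy
        exact χ.one_of_mem_closedBall (Metric.ball_subset_closedBall hy)
      rw [this.fderiv_eq]
      simp
  set V : EuclideanSpace ℝ (Fin d) → EuclideanSpace ℝ (Fin d) := fun x => χ x • F x with hV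
  have hVout : ∀ x : EuclideanSpace ℝ (Fin d), r < ‖x‖ → V =ᶠ[𝓝 x] fun _ => 0 := by
    intro x hx
    filter_upwards [(isOpen_lt continuous_const continuous_norm).mem_nhds hx] with y hy
    have : χ y = 0 := χ.zero_of_le_dist (by simpa using le_of_lt hy)
    simp [hV, this]
  have hFd : ∀ x ∈ Ω, ‖x‖ ≤ r → ContDiffAt ℝ 1 F x := by
    intro x hx hxr
    have hx0 : x ≠ 0 := fun h => h0Ω (h ▸ hx)
    obtain ⟨h1, h2⟩ := hgood x hx0 hxr (hQ x hx (by linarith))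
    exact contDiffAt_exteriorBallField hx0 h1 h2
  have hVd : ∀ x ∈ Ω, ContDiffAt ℝ 1 V x := by
    intro x hx
    rcases le_or_gt ‖x‖ r with h | h
    · exact χ.contDiff.contDiffAt.smul (hFd x hx h)
    · exact contDiffAt_const.congr_of_eventuallyEq (hVout x h)
  have hbd : ∀ x ∈ Ω, χ x * (κ / ‖x‖ ^ 2) - |C₁| ≤ divergence V x - ‖V x‖ ^ 2 := by
    intro x hx
    rcases le_or_gt ‖x‖ r with h | h
    · have hx0 : x ≠ 0 := fun h => h0Ω (h ▸ hx)
      obtain ⟨h1, h2⟩ := hgood x hx0 h (hQ x hx (by linarith))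
      rw [hV, divergence_smul (χ.contDiff.differentiable (n := 1) one_ne_zero x)
        ((hFd x hx h).differentiableAt one_ne_zero), norm_smul, mul_pow, Real.norm_eq_abs, sq_abs]
      have e := divergence_sub_sq_exteriorBallField hx0 h1 h2
      have h3 : κ / ‖x‖ ^ 2 ≤ divergence F x - ‖F x‖ ^ 2 := by
        rw [e, mul_comm (‖x‖ ^ 2), ← div_div, ← mul_div_assoc]
        gcongr
        exact (hr₁b x (by simpa using lt_of_le_of_lt h hrr₁)).le
      have h4 : χ x * (κ / ‖x‖ ^ 2) ≤ χ x * (divergence F x - ‖F x‖ ^ 2) :=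
        mul_le_mul_of_nonneg_left h3 χ.nonneg
      -- Since `0 ≤ χ ≤ 1`, the quadratic term of `χ F` is dominated, and only `∇χ · F` remains as
      -- an error.
      have h5 : χ x ^ 2 * ‖F x‖ ^ 2 ≤ χ x * ‖F x‖ ^ 2 := by
        gcongr
        nlinarith [χ.nonneg (x := x), χ.le_one (x := x)]
      have := hC₁' x hx h
      linarith
    · have h1 : divergence V x = 0 := by
        rw [(hVout x h).divergence_eq]; simp [divergence]
      have h2 : V x = 0 := (hVout x h).self_of_nhds
      have h3 : χ x = 0 := χ.zero_of_le_dist (by simpa using h.le)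
      simp [h1, h2, h3]
  -- The second term pays for `(1 - χ) κ/|x|²`, which vanishes for `|x| ≤ r/2`.
  set C := |C₁| + |κ| / (r / 2) ^ 2
  have hbd' : ∀ x ∈ Ω, κ / ‖x‖ ^ 2 - C ≤ divergence V x - ‖V x‖ ^ 2 := by
    intro x hx
    refine le_trans ?_ (hbd x hx)
    suffices h : (1 - χ x) * (κ / ‖x‖ ^ 2) ≤ |κ| / (r / 2) ^ 2 by
      simp only [C]; linarith
    rcases le_or_gt ‖x‖ (r / 2) with h | h
    · rw [show χ x = 1 from χ.one_of_mem_closedBall (by simpa using h)]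
      simp only [sub_self, zero_mul]; positivity
    · have h1 : κ / ‖x‖ ^ 2 ≤ |κ| / (r / 2) ^ 2 := by
        gcongr
        exact le_abs_self κ
      calc (1 - χ x) * (κ / ‖x‖ ^ 2) ≤ (1 - χ x) * (|κ| / (r / 2) ^ 2) :=
            mul_le_mul_of_nonneg_left h1 (by linarith [χ.le_one (x := x)])
        _ ≤ 1 * (|κ| / (r / 2) ^ 2) := by
            gcongr
            linarith [χ.nonneg (x := x)]
        _ = _ := one_mul _
  refine ⟨C, fun w hw => ?_⟩
  have hI : Integrable (fun x => w x ^ 2 / ‖x‖ ^ 2) := by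
    simp_rw [div_eq_inv_mul]
    refine Continuous.integrable_mul_of_continuousAt (hw.contDiff.continuous.pow 2)
      hw.hasCompactSupport_sq fun x hx => ?_
    have hx : x ∈ tsupport w := closure_mono (show Function.support (fun y => w y ^ 2) ⊆
      Function.support w from fun y hy hy' => hy (by simp [hy'])) hx
    have hx0 : x ≠ 0 := fun h => h0Ω (h ▸ hw.tsupport_subset hx)
    exact ContinuousAt.inv₀ (by fun_prop) (by simpa using hx0)
  refine ⟨hI, ?_⟩
  obtain ⟨hVI, hVle⟩ := integral_divergence_sub_sq_mul_sq_le hw.contDiff_one hw.hasCompactSupport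
    fun x hx => hVd x (hw.tsupport_subset hx)
  have : ∫ x, (κ * (w x ^ 2 / ‖x‖ ^ 2) - C * w x ^ 2) ≤
      ∫ x, (divergence V x - ‖V x‖ ^ 2) * w x ^ 2 := by
    refine integral_mono ((hI.const_mul κ).sub (hw.integrable_sq.const_mul C)) hVI fun x => ?_
    by_cases hx : x ∈ Ω
    · calc κ * (w x ^ 2 / ‖x‖ ^ 2) - C * w x ^ 2 = (κ / ‖x‖ ^ 2 - C) * w x ^ 2 := by ring
        _ ≤ _ := mul_le_mul_of_nonneg_right (hbd' x hx) (sq_nonneg _)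
    · simp [hw.eq_zero hx]
  rw [integral_sub (hI.const_mul κ) (hw.integrable_sq.const_mul C), integral_const_mul,
    integral_const_mul] at this
  linarith

/-- Fatou's lemma in a form that also yields integrability of the limit. -/
theorem _root_.MeasureTheory.integrable_and_integral_le_of_tendsto {α : Type*}
    [MeasurableSpace α] {μ : Measure α} {f : ℕ → α → ℝ} {g : α → ℝ} {B : ℝ}
    (hf : ∀ n, Integrable (f n) μ) (h0 : ∀ n x, 0 ≤ f n x) (hB : ∀ n, ∫ x, f n x ∂μ ≤ B)
    (hg : AEStronglyMeasurable g μ) (hlim : ∀ x, Tendsto (fun n => f n x) atTop (𝓝 (g x))) :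
    Integrable g μ ∧ ∫ x, g x ∂μ ≤ B := by
  have hg0 : ∀ x, 0 ≤ g x := fun x => ge_of_tendsto' (hlim x) fun n => h0 n x
  have hB0 : 0 ≤ B := (integral_nonneg (h0 0)).trans (hB 0)
  have key : ∫⁻ x, ENNReal.ofReal (g x) ∂μ ≤ ENNReal.ofReal B := by
    have h1 : ∀ x, ENNReal.ofReal (g x) = liminf (fun n => ENNReal.ofReal (f n x)) atTop :=
      fun x => ((ENNReal.continuous_ofReal.tendsto _).comp (hlim x)).liminf_eq.symm
    simp_rw [h1]
    refine (lintegral_liminf_le' fun n => (hf n).aemeasurable.ennreal_ofReal).trans ?_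
    refine liminf_le_of_frequently_le' (Frequently.of_forall fun n => ?_)
    rw [← ofReal_integral_eq_lintegral_ofReal (hf n) (ae_of_all _ (h0 n))]
    exact ENNReal.ofReal_le_ofReal (hB n)
  have hI : Integrable g μ := by
    refine ⟨hg, (hasFiniteIntegral_iff_ofReal (ae_of_all _ hg0)).2 ?_⟩
    exact key.trans_lt ENNReal.ofReal_lt_top
  refine ⟨hI, ?_⟩
  rw [← ofReal_integral_eq_lintegral_ofReal hI (ae_of_all _ hg0)] at key
  exact (ENNReal.ofReal_le_ofReal_iff hB0).1 key

/-- The optimal field `c x/|x|²`, `c = (d-2)/2`, is singular at `0`, where `w` need not vanish. With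
`c x/(|x|² + ε)` the weight exceeds `c² |x|²/(|x|² + ε)²` by the nonnegative quantity
`c(2c+2)ε/(|x|² + ε)²`; then `ε → 0` by Fatou. -/
theorem hardy_of_three_le (hd : 3 ≤ d) {w : EuclideanSpace ℝ (Fin d) → ℝ}
    (hw : IsTestFunction Ω w) : Integrable (fun x => w x ^ 2 / ‖x‖ ^ 2) ∧
      ((d : ℝ) - 2) ^ 2 / 4 * ∫ x, w x ^ 2 / ‖x‖ ^ 2 ≤ ∫ x, ‖gradient w x‖ ^ 2 := by
  have hd' : (3 : ℝ) ≤ d := by exact_mod_cast hd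
  set c : ℝ := ((d : ℝ) - 2) / 2 with hc
  have hc0 : 0 < c := by rw [hc]; linarith
  have hreg : ∀ ε : ℝ, 0 < ε →
      Integrable (fun x => ‖x‖ ^ 2 / (‖x‖ ^ 2 + ε) ^ 2 * w x ^ 2) ∧
      ∫ x, ‖x‖ ^ 2 / (‖x‖ ^ 2 + ε) ^ 2 * w x ^ 2 ≤ (∫ x, ‖gradient w x‖ ^ 2) / c ^ 2 := by
    intro ε hε
    have hpos : ∀ x : EuclideanSpace ℝ (Fin d), 0 < ‖x‖ ^ 2 + ε := fun x => by positivity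
    have hN : ContDiff ℝ 1 (fun x : EuclideanSpace ℝ (Fin d) => ‖x‖ ^ 2 + ε) :=
      (contDiff_norm_sq ℝ).add contDiff_const
    have hh : ContDiff ℝ 1 (fun x : EuclideanSpace ℝ (Fin d) => c * (‖x‖ ^ 2 + ε)⁻¹) :=
      contDiff_const.mul (hN.inv fun x => (hpos x).ne')
    have hL : ContDiff ℝ 1 (fun x : EuclideanSpace ℝ (Fin d) => (1 : ℝ) • x - 0) := by fun_prop
    obtain ⟨hI, hle⟩ := integral_divergence_sub_sq_mul_sq_le hw.contDiff_one hw.hasCompactSupport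
      (F := fun x => (c * (‖x‖ ^ 2 + ε)⁻¹) • ((1 : ℝ) • x - 0))
      fun x _ => (hh.smul hL).contDiffAt
    have hI' : Integrable (fun x => ‖x‖ ^ 2 / (‖x‖ ^ 2 + ε) ^ 2 * w x ^ 2) := by
      refine Continuous.integrable_mul_of_continuousAt (hw.contDiff.continuous.pow 2)
        hw.hasCompactSupport_sq fun x _ => ContinuousAt.div (by fun_prop) (by fun_prop) ?_
      exact (pow_pos (hpos x) 2).ne'
    refine ⟨hI', ?_⟩
    rw [le_div_iff₀ (by positivity), mul_comm, ← integral_const_mul]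
    refine (integral_mono (hI'.const_mul _) hI fun x => ?_).trans hle
    beta_reduce
    rw [← mul_assoc]
    refine mul_le_mul_of_nonneg_right ?_ (sq_nonneg _)
    have D : HasFDerivAt (fun y : EuclideanSpace ℝ (Fin d) => c * (‖y‖ ^ 2 + ε)⁻¹)
        (c • (-(‖x‖ ^ 2 + ε) ^ 2)⁻¹ • (2 : ℝ) • innerSL ℝ x) x := by
      refine (((hasDerivAt_inv (hpos x).ne').comp_hasFDerivAt x
        ((hasStrictFDerivAt_norm_sq x).hasFDerivAt.add_const ε)).const_mul c).congr_fderiv ?_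
      simp [inv_neg, two_smul]
    rw [divergence_smul D.differentiableAt (hL.differentiable one_ne_zero x),
      divergence_const_smul_sub, D.fderiv]
    simp only [_root_.smul_apply, innerSL_apply_apply, smul_eq_mul, one_smul, sub_zero,
      real_inner_self_eq_norm_sq, norm_smul, mul_pow, Real.norm_eq_abs, sq_abs]
    have h1 := hpos x
    have h2 : 0 ≤ ‖x‖ ^ 2 := by positivity
    generalize ‖x‖ ^ 2 = a at *
    have hdc : (d : ℝ) = 2 * c + 2 := by rw [hc]; ring
    rw [hdc]
    have : c * (a + ε)⁻¹ * (1 * (2 * c + 2)) + c * ((-(a + ε) ^ 2)⁻¹ * (2 * a)) -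
        c ^ 2 * (a + ε)⁻¹ ^ 2 * a - c ^ 2 * (a / (a + ε) ^ 2) =
        c * (2 * c + 2) * ε / (a + ε) ^ 2 := by
      rw [inv_neg]
      field_simp
      ring
    have : 0 ≤ c * (2 * c + 2) * ε / (a + ε) ^ 2 := by positivity
    linarith
  have hmeas : AEStronglyMeasurable (fun x => w x ^ 2 / ‖x‖ ^ 2) volume :=
    ((hw.contDiff.continuous.measurable.pow_const 2).div
      (measurable_norm.pow_const 2)).aestronglyMeasurable
  obtain ⟨hI, hle⟩ := integrable_and_integral_le_of_tendsto
    (f := fun (n : ℕ) x => ‖x‖ ^ 2 / (‖x‖ ^ 2 + 1 / ((n : ℝ) + 1)) ^ 2 * w x ^ 2)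
    (fun n => (hreg _ (by positivity)).1) (fun n x => by positivity)
    (fun n => (hreg _ (by positivity)).2) hmeas fun x => by
      by_cases hx : x = 0
      · simp [hx]
      · have hx' : ‖x‖ ≠ 0 := by simpa using hx
        have h1 : Tendsto (fun n : ℕ => ‖x‖ ^ 2 + 1 / ((n : ℝ) + 1)) atTop (𝓝 (‖x‖ ^ 2 + 0)) :=
          tendsto_const_nhds.add tendsto_one_div_add_atTop_nhds_zero_nat
        have h2 := ((tendsto_const_nhds (x := ‖x‖ ^ 2)).div (h1.pow 2)
          (by simpa using hx)).mul_const (w x ^ 2)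
        rw [show w x ^ 2 / ‖x‖ ^ 2 = ‖x‖ ^ 2 / (‖x‖ ^ 2 + 0) ^ 2 * w x ^ 2 by
          rw [add_zero]; field_simp]
        exact h2
  refine ⟨hI, ?_⟩
  rw [le_div_iff₀ (by positivity)] at hle
  rw [show ((d : ℝ) - 2) ^ 2 / 4 = c ^ 2 by rw [hc]; ring, mul_comm]
  exact hle

theorem hardy (hΩ : IsSmoothBoundedDomain Ω)
    (h0 : (0 : EuclideanSpace ℝ (Fin d)) ∈ frontier Ω ∨
      (3 ≤ d ∧ (0 : EuclideanSpace ℝ (Fin d)) ∈ Ω)) {κ : ℝ} (hκ : κ < hardyConst Ω) :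
    ∃ C, ∀ w, IsTestFunction Ω w → Integrable (fun x => w x ^ 2 / ‖x‖ ^ 2) ∧
      κ * ∫ x, w x ^ 2 / ‖x‖ ^ 2 ≤ (∫ x, ‖gradient w x‖ ^ 2) + C * ∫ x, w x ^ 2 := by
  by_cases h : (0 : EuclideanSpace ℝ (Fin d)) ∈ frontier Ω
  · rw [hardyConst, if_pos h] at hκ
    exact hardy_of_mem_frontier hΩ h hκ
  · rw [hardyConst, if_neg h] at hκ
    refine ⟨0, fun w hw => ?_⟩
    obtain ⟨hI, hle⟩ := hardy_of_three_le (h0.resolve_left h).1 hw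
    refine ⟨hI, ?_⟩
    have : κ * ∫ x, w x ^ 2 / ‖x‖ ^ 2 ≤ ((d : ℝ) - 2) ^ 2 / 4 * ∫ x, w x ^ 2 / ‖x‖ ^ 2 :=
      mul_le_mul_of_nonneg_right hκ.le (integral_nonneg fun x => by positivity)
    linarith

theorem hardyConst_pos (h0 : (0 : EuclideanSpace ℝ (Fin d)) ∈ frontier Ω ∨
      (3 ≤ d ∧ (0 : EuclideanSpace ℝ (Fin d)) ∈ Ω)) : 0 < hardyConst Ω := by
  by_cases h : (0 : EuclideanSpace ℝ (Fin d)) ∈ frontier Ω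
  · rw [hardyConst, if_pos h]
    rcases Nat.eq_zero_or_pos d with rfl | hd
    -- In dimension `0` the space is a point, so no set has a boundary point.
    · rcases Ω.eq_empty_or_nonempty with rfl | hne
      · simp at h
      · simp [Subsingleton.eq_univ_of_nonempty hne] at h
    · have : (0 : ℝ) < d := by exact_mod_cast hd
      positivity
  · rw [hardyConst, if_neg h]
    have : (3 : ℝ) ≤ d := by exact_mod_cast (h0.resolve_left h).1
    have : 0 < (d : ℝ) - 2 := by linarith
    positivity

end Hardy


/-! ### Mollification with control of the gradient. -/

section Smoothing

variable {d : ℕ} {Ω : Set (EuclideanSpace ℝ (Fin d))}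

theorem norm_gradient {f : EuclideanSpace ℝ (Fin d) → ℝ} (x : EuclideanSpace ℝ (Fin d)) :
    ‖gradient f x‖ = ‖fderiv ℝ f x‖ := by
  rw [gradient, LinearIsometryEquiv.norm_map]

/-- Smoothing on compact sets of a bounded function on `Ω` whose gradient has square at most `V`
(in the sense that it is `K`-Lipschitz along segments on which `V ≤ K ^ 2`). -/
theorem exists_smooth_approx (hΩ : IsOpen Ω) (hb : Bornology.IsBounded Ω)
    {V f : EuclideanSpace ℝ (Fin d) → ℝ} (hV : ContinuousOn V (closure Ω)) {T : ℝ}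
    (hfT : ∀ x ∈ Ω, |f x| ≤ T)
    (hf : ∀ x y, segment ℝ x y ⊆ Ω → ∀ k, 0 ≤ k → (∀ z ∈ segment ℝ x y, V z ≤ k ^ 2) →
      |f x - f y| ≤ k * ‖x - y‖)
    {s : Set (EuclideanSpace ℝ (Fin d))} (hs : IsCompact s) (hsΩ : s ⊆ Ω) {ε ε' : ℝ} (hε : 0 < ε)
    (hε' : 0 < ε') :
    ∃ g : EuclideanSpace ℝ (Fin d) → ℝ, ContDiff ℝ ∞ g ∧
      ∀ x ∈ s, |g x - f x| ≤ ε' ∧ ‖gradient g x‖ ^ 2 ≤ max (V x) 0 + ε := by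
  have hcomp : IsCompact (closure Ω) := hb.isCompact_closure
  obtain ⟨δ₁, hδ₁, huc⟩ := Metric.uniformContinuousOn_iff.1
    (hcomp.uniformContinuousOn_of_continuous hV) ε hε
  obtain ⟨M, hM⟩ := hcomp.exists_bound_of_continuousOn hV
  obtain ⟨δ₂, hδ₂, hthick⟩ := hs.exists_thickening_subset_open hΩ hsΩ
  set L := Real.sqrt |M| with hL
  have hL0 : 0 ≤ L := Real.sqrt_nonneg _
  have hVL : ∀ z ∈ Ω, V z ≤ L ^ 2 := fun z hz => by
    rw [hL, Real.sq_sqrt (abs_nonneg _)]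
    exact (le_abs_self _).trans ((hM z (subset_closure hz)).trans (le_abs_self _))
  -- At scale `2r`, `V` varies by less than `ε` and balls centred in `s` stay in `Ω`; also `L r ≤
  -- ε'`, with `L` a Lipschitz constant along every segment in `Ω`.
  obtain ⟨r, hr, hrlt⟩ := exists_between
    (show (0 : ℝ) < min (min (δ₁ / 2) (δ₂ / 2)) (ε' / (L + 1)) by positivity)
  obtain ⟨⟨hr1, hr2⟩, hr3⟩ : (r < δ₁ / 2 ∧ r < δ₂ / 2) ∧ r < ε' / (L + 1) := by
    simpa [lt_min_iff] using hrlt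
  have hrL : L * r ≤ ε' := by
    rw [lt_div_iff₀ (by positivity)] at hr3
    nlinarith
  have hball : ∀ x ∈ s, Metric.ball x (2 * r) ⊆ Ω := fun x hx y hy => by
    refine hthick (Metric.mem_thickening_iff.2 ⟨x, hx, ?_⟩)
    have := Metric.mem_ball.1 hy
    linarith
  let η : ContDiffBump (0 : EuclideanSpace ℝ (Fin d)) := ⟨r / 2, r, by positivity, by linarith⟩
  set f₁ := Ω.indicator f with hf₁
  have hf₁e : ∀ x ∈ Ω, f₁ x = f x := fun x hx => indicator_of_mem hx f
  have hcont : ContinuousOn f Ω := by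
    intro x hx
    obtain ⟨ρ, hρ, hρΩ⟩ := Metric.isOpen_iff.1 hΩ x hx
    refine ContinuousAt.continuousWithinAt ?_
    refine continuousAt_of_locally_lipschitz hρ L fun y hy => ?_
    have hseg : segment ℝ y x ⊆ Ω :=
      ((convex_ball x ρ).segment_subset hy (Metric.mem_ball_self hρ)).trans hρΩ
    rw [Real.dist_eq, dist_eq_norm]
    exact hf y x hseg L hL0 fun z hz => hVL z (hseg hz)
  have hmeas : AEStronglyMeasurable f₁ volume :=
    (aestronglyMeasurable_indicator_iff hΩ.measurableSet).2
      (hcont.aestronglyMeasurable hΩ.measurableSet)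
  have hloc : LocallyIntegrable f₁ volume := by
    refine (locallyIntegrable_const |T|).mono hmeas (ae_of_all _ fun x => ?_)
    by_cases hx : x ∈ Ω
    · rw [hf₁e x hx]
      simpa using (hfT x hx).trans (le_abs_self T)
    · simp [hf₁, hx]
  have hηs : HasCompactSupport (η.normed volume) := η.hasCompactSupport_normed
  have hηc : ContDiff ℝ ∞ (η.normed volume) := η.contDiff_normed
  have hex := hηs.convolutionExists_left (ContinuousLinearMap.lsmul ℝ ℝ) hηc.continuous hloc
  set g := MeasureTheory.convolution (η.normed volume) f₁ (ContinuousLinearMap.lsmul ℝ ℝ) volume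
    with hg
  have hgs : ContDiff ℝ ∞ g :=
    hηs.contDiff_convolution_left (ContinuousLinearMap.lsmul ℝ ℝ) hηc hloc
  refine ⟨g, hgs, fun x hx => ⟨?_, ?_⟩⟩
  · have hxΩ := hsΩ hx
    have := ContDiffBump.dist_normed_convolution_le (φ := η) (g := f₁) (x₀ := x) (ε := ε') hmeas
      fun y hy => by
        have hy' : dist y x < r := hy
        have hseg : segment ℝ y x ⊆ Ω := by
          refine ((convex_ball x (2 * r)).segment_subset ?_
            (Metric.mem_ball_self (by positivity))).trans (hball x hx)
          exact Metric.mem_ball.2 (by linarith)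
        rw [hf₁e x hxΩ, hf₁e y (hseg (left_mem_segment ℝ y x)), Real.dist_eq]
        refine (hf y x hseg L hL0 fun z hz => hVL z (hseg hz)).trans ?_
        rw [← dist_eq_norm]
        exact (mul_le_mul_of_nonneg_left hy'.le hL0).trans hrL
    rw [hf₁e x hxΩ, Real.dist_eq] at this
    exact this
  · have hk0 : 0 ≤ max (V x) 0 + ε := by positivity
    rw [norm_gradient]
    refine (Real.le_sqrt (norm_nonneg _) hk0).1 ?_
    refine norm_fderiv_le_of_lip' ℝ (Real.sqrt_nonneg _) ?_
    filter_upwards [Metric.ball_mem_nhds x hr] with y hy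
    have hy' : dist y x < r := hy
    -- Both arguments are translated by the same `t`, so `f` is compared along a segment inside the
    -- ball of radius `2r` about `x`, where `V ≤ V x + ε`. Averaging preserves the resulting
    -- Lipschitz bound.
    have e : g y - g x = ∫ t, η.normed volume t * (f₁ (y - t) - f₁ (x - t)) := by
      rw [hg, convolution_def, convolution_def, ← integral_sub (hex y) (hex x)]
      simp [mul_sub]
    rw [e]
    have hbound : ∀ t, ‖η.normed volume t * (f₁ (y - t) - f₁ (x - t))‖ ≤
        η.normed volume t * (Real.sqrt (max (V x) 0 + ε) * ‖y - x‖) := by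
      intro t
      rw [norm_mul, Real.norm_of_nonneg (η.nonneg_normed t)]
      by_cases ht : t ∈ Function.support (η.normed volume)
      · refine mul_le_mul_of_nonneg_left ?_ (η.nonneg_normed t)
        rw [η.support_normed_eq, mem_ball_zero_iff] at ht
        have ht' : ‖t‖ < r := ht
        have hyt : y - t ∈ Metric.ball x (2 * r) := by
          rw [Metric.mem_ball, dist_eq_norm, show y - t - x = (y - x) - t by abel]
          rw [dist_eq_norm] at hy'
          linarith [norm_sub_le (y - x) t]
        have hxt : x - t ∈ Metric.ball x (2 * r) := by
          rw [Metric.mem_ball, dist_eq_norm, show x - t - x = -t by abel, norm_neg]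
          linarith
        have hseg := (convex_ball x (2 * r)).segment_subset hyt hxt
        rw [hf₁e _ (hball x hx hyt), hf₁e _ (hball x hx hxt), Real.norm_eq_abs]
        refine (hf _ _ (hseg.trans (hball x hx)) (Real.sqrt (max (V x) 0 + ε))
          (Real.sqrt_nonneg _) fun z hz => ?_).trans ?_
        · rw [Real.sq_sqrt hk0]
          have hz' : dist z x < 2 * r := hseg hz
          have := huc z (subset_closure (hball x hx (hseg hz))) x (subset_closure (hsΩ hx))
            (by linarith)
          rw [Real.dist_eq, abs_lt] at this
          linarith [le_max_left (V x) 0]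
        · rw [show y - t - (x - t) = y - x by abel]
      · rw [Function.notMem_support.1 ht]; simp
    refine (norm_integral_le_of_norm_le ?_ (ae_of_all _ hbound)).trans ?_
    · exact (η.integrable_normed).mul_const _
    · rw [integral_mul_const, η.integral_normed, one_mul]

end Smoothing


/-! ### The Agmon distance and its Lipschitz property. -/

section AgmonDistance

variable {d : ℕ} {Ω : Set (EuclideanSpace ℝ (Fin d))} {q : EuclideanSpace ℝ (Fin d) → ℝ} {E : ℝ}
  {x y x' : EuclideanSpace ℝ (Fin d)} {c : ℝ → EuclideanSpace ℝ (Fin d)}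

theorem agmonLength_nonneg : 0 ≤ agmonLength q E c :=
  intervalIntegral.integral_nonneg zero_le_one fun t _ => by positivity

theorem bddBelow_agmonLength :
    BddBelow {l | ∃ c, IsPiecewiseC1Path Ω x x' c ∧ l = agmonLength q E c} :=
  ⟨0, by rintro _ ⟨c, -, rfl⟩; exact agmonLength_nonneg⟩

theorem agmonDist_nonneg : 0 ≤ agmonDist Ω q E x x' :=
  Real.sInf_nonneg (by rintro _ ⟨c, -, rfl⟩; exact agmonLength_nonneg)

theorem agmonDist_self (hx : x ∈ Ω) : agmonDist Ω q E x x = 0 := by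
  refine le_antisymm ?_ agmonDist_nonneg
  refine csInf_le bddBelow_agmonLength ⟨fun _ => x, ⟨continuousOn_const, rfl, rfl, fun _ _ => hx,
    1, fun i => if i = 0 then 0 else 1, ?_, by simp, by simp, fun _ _ => contDiffOn_const⟩, ?_⟩
  · refine monotone_nat_of_le_succ fun n => ?_
    split_ifs <;> simp_all
  · simp [agmonLength]

/-- Splitting the length of a concatenated path requires integrability. On each closed piece the
integrand built from `derivWithin` is continuous, and it agrees with the one built from `deriv` in
the interior. -/
theorem IsPiecewiseC1Path.intervalIntegrable (hq : ContinuousOn q (closure Ω))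
    (hc : IsPiecewiseC1Path Ω x x' c) :
    IntervalIntegrable (fun t => Real.sqrt (max (q (c t) ^ 2 - E) 0) * ‖deriv c t‖) volume 0 1 := by
  obtain ⟨n, t, htm, ht0, htn, hct⟩ := hc.piecewise
  suffices h : IntervalIntegrable (fun s => Real.sqrt (max (q (c s) ^ 2 - E) 0) * ‖deriv c s‖)
      volume (t 0) (t n) by rwa [ht0, htn] at h
  refine IntervalIntegrable.trans_iterate fun i hi => ?_
  rcases (htm i.le_succ).eq_or_lt with h | h
  · rw [← Nat.succ_eq_add_one, ← h]
  · have hsub : Icc (t i) (t (i + 1)) ⊆ Icc 0 1 :=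
      Icc_subset_Icc (ht0 ▸ htm i.zero_le) (htn ▸ htm hi)
    have h1 : ContinuousOn (fun s => Real.sqrt (max (q (c s) ^ 2 - E) 0) *
        ‖derivWithin c (Icc (t i) (t (i + 1))) s‖) (Icc (t i) (t (i + 1))) := by
      have hqc : ContinuousOn (fun s => q (c s)) (Icc (t i) (t (i + 1))) :=
        hq.comp (hc.continuousOn.mono hsub) fun s hs => subset_closure (hc.mapsTo (hsub hs))
      refine ContinuousOn.mul ?_ ?_
      · exact Real.continuous_sqrt.comp_continuousOn
          (((hqc.pow 2).sub continuousOn_const).sup continuousOn_const)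
      · exact ((hct i hi).continuousOn_derivWithin (uniqueDiffOn_Icc h) le_rfl).norm
    rw [intervalIntegrable_iff_integrableOn_Ioo_of_le h.le]
    refine (h1.integrableOn_Icc.mono_set Ioo_subset_Icc_self).congr_fun (fun s hs => ?_)
      measurableSet_Ioo
    beta_reduce
    rw [derivWithin_of_mem_nhds (Icc_mem_nhds hs.1 hs.2)]

/-- The path which goes along the segment from `x` to `y`, then along `c`. -/
noncomputable def segmentConcat (x y : EuclideanSpace ℝ (Fin d))
    (c : ℝ → EuclideanSpace ℝ (Fin d)) (t : ℝ) : EuclideanSpace ℝ (Fin d) :=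
  if t ≤ 1 / 2 then x + (2 * t) • (y - x) else c (2 * t - 1)

theorem segmentConcat_of_le {t : ℝ} (ht : t ≤ 1 / 2) :
    segmentConcat x y c t = x + (2 * t) • (y - x) := if_pos ht

theorem segmentConcat_of_ge (hc : c 0 = y) {t : ℝ} (ht : 1 / 2 ≤ t) :
    segmentConcat x y c t = c (2 * t - 1) := by
  rcases ht.eq_or_lt with rfl | h
  · rw [segmentConcat_of_le le_rfl]
    norm_num [hc]
  · exact if_neg (not_le.2 h)

theorem IsPiecewiseC1Path.segmentConcat (hc : IsPiecewiseC1Path Ω y x' c)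
    (hseg : segment ℝ x y ⊆ Ω) : IsPiecewiseC1Path Ω x x' (segmentConcat x y c) := by
  have hmaps : MapsTo (fun t : ℝ => 2 * t - 1) (Icc (1 / 2) 1) (Icc 0 1) := fun t ht => by
    constructor <;> linarith [ht.1, ht.2]
  have hlin : ContDiff ℝ 1 (fun t : ℝ => x + (2 * t) • (y - x)) := by fun_prop
  refine ⟨?_, ?_, ?_, ?_, ?_⟩
  · have h1 : ContinuousOn (Grushin.segmentConcat x y c) (Icc 0 (1 / 2)) :=
      hlin.continuous.continuousOn.congr fun t ht => segmentConcat_of_le ht.2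
    have h2 : ContinuousOn (Grushin.segmentConcat x y c) (Icc (1 / 2) 1) :=
      (hc.continuousOn.comp (by fun_prop) hmaps).congr fun t ht => segmentConcat_of_ge hc.source ht.1
    have := h1.union_of_isClosed h2 isClosed_Icc isClosed_Icc
    rwa [Icc_union_Icc_eq_Icc (by norm_num) (by norm_num)] at this
  · rw [segmentConcat_of_le (by norm_num)]; simp
  · rw [segmentConcat_of_ge hc.source (by norm_num), ← hc.target]; norm_num
  · intro t ht
    rcases le_total t (1 / 2) with h | h
    · rw [segmentConcat_of_le h]
      refine hseg ?_
      rw [segment_eq_image']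
      exact ⟨2 * t, ⟨by linarith [ht.1], by linarith⟩, rfl⟩
    · rw [segmentConcat_of_ge hc.source h]
      exact hc.mapsTo (hmaps ⟨h, ht.2⟩)
  · obtain ⟨n, t, htm, ht0, htn, hct⟩ := hc.piecewise
    -- The old nodes are squeezed into `[1/2, 1]` and shifted by one index; as `t 0 = 0`, the first
    -- piece is `[0, 1/2]`.
    refine ⟨n + 1, fun i => Nat.casesOn i 0 fun i => (1 + t i) / 2, ?_, rfl, ?_, ?_⟩
    · refine monotone_nat_of_le_succ fun i => ?_
      cases i with
      | zero => simp [ht0]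
      | succ i =>
        have := htm i.le_succ
        simp only [Nat.succ_eq_add_one] at this
        show (1 + t i) / 2 ≤ (1 + t (i + 1)) / 2
        linarith
    · show (1 + t n) / 2 = 1
      rw [htn]; norm_num
    · intro i hi
      cases i with
      | zero =>
        refine hlin.contDiffOn.congr fun s hs => segmentConcat_of_le ?_
        have : s ≤ (1 + t 0) / 2 := hs.2
        rw [ht0] at this; linarith
      | succ i =>
        have h0 : 0 ≤ t i := ht0 ▸ htm i.zero_le
        refine ContDiffOn.congr (f := fun s => c (2 * s - 1)) ?_ fun s hs =>
          segmentConcat_of_ge hc.source ?_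
        · refine (hct i (by omega)).comp (by fun_prop) fun s hs => ?_
          have h1 : (1 + t i) / 2 ≤ s := hs.1
          have h2 : s ≤ (1 + t (i + 1)) / 2 := hs.2
          constructor <;> linarith
        · have : (1 + t i) / 2 ≤ s := hs.1
          linarith

/-- The second half is `c` at double speed, hence of the same length. The first half has speed `2 |x
- y|` during time `1/2`, with density at most `k`. -/
theorem agmonLength_segmentConcat_le (hq : ContinuousOn q (closure Ω))
    (hc : IsPiecewiseC1Path Ω y x' c) (hseg : segment ℝ x y ⊆ Ω) {k : ℝ} (hk : 0 ≤ k)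
    (hqk : ∀ z ∈ segment ℝ x y, q z ^ 2 - E ≤ k ^ 2) :
    agmonLength q E (segmentConcat x y c) ≤ agmonLength q E c + k * ‖x - y‖ := by
  have hI := (hc.segmentConcat hseg).intervalIntegrable (E := E) hq
  have hI1 := hI.mono_set (c := 0) (d := 1 / 2) (by
    rw [uIcc_of_le (by norm_num), uIcc_of_le (by norm_num)]
    exact Icc_subset_Icc le_rfl (by norm_num))
  have hI2 := hI.mono_set (c := 1 / 2) (d := 1) (by
    rw [uIcc_of_le (by norm_num), uIcc_of_le (by norm_num)]
    exact Icc_subset_Icc (by norm_num) le_rfl)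
  have e2 : ∫ t in (1 / 2 : ℝ)..1, Real.sqrt (max (q (segmentConcat x y c t) ^ 2 - E) 0) *
      ‖deriv (segmentConcat x y c) t‖ = agmonLength q E c := by
    have : ∫ t in (1 / 2 : ℝ)..1, Real.sqrt (max (q (segmentConcat x y c t) ^ 2 - E) 0) *
        ‖deriv (segmentConcat x y c) t‖ =
        ∫ t in (1 / 2 : ℝ)..1, 2 * (Real.sqrt (max (q (c (2 * t - 1)) ^ 2 - E) 0) *
          ‖deriv c (2 * t - 1)‖) := by
      refine intervalIntegral.integral_congr_ae (ae_of_all _ fun t ht => ?_)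
      rw [uIoc_of_le (by norm_num)] at ht
      have hev : segmentConcat x y c =ᶠ[𝓝 t] fun s => c (2 * s - 1) := by
        filter_upwards [lt_mem_nhds ht.1] with s hs
        exact segmentConcat_of_ge hc.source hs.le
      have hder : deriv (fun s => c (2 * s - 1)) t = (2 : ℝ) • deriv c (2 * t - 1) := by
        rw [deriv_comp_mul_left (2 : ℝ) (fun s => c (s - 1)) t, deriv_comp_sub_const]
      rw [hev.deriv_eq, hev.self_of_nhds, hder, norm_smul]
      norm_num
      ring
    rw [this, intervalIntegral.integral_const_mul, intervalIntegral.integral_comp_mul_sub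
      (fun t => Real.sqrt (max (q (c t) ^ 2 - E) 0) * ‖deriv c t‖) two_ne_zero 1]
    rw [agmonLength, smul_eq_mul, ← mul_assoc]
    norm_num
  have e1 : ∫ t in (0 : ℝ)..(1 / 2), Real.sqrt (max (q (segmentConcat x y c t) ^ 2 - E) 0) *
      ‖deriv (segmentConcat x y c) t‖ ≤ k * ‖x - y‖ := by
    refine (le_abs_self _).trans ?_
    have hb : ∀ᵐ t, t ∈ uIoc (0 : ℝ) (1 / 2) →
        ‖Real.sqrt (max (q (segmentConcat x y c t) ^ 2 - E) 0) *
          ‖deriv (segmentConcat x y c) t‖‖ ≤ k * (2 * ‖x - y‖) := by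
      have hne : ∀ᵐ t : ℝ, t ≠ 1 / 2 := by simp [ae_iff, measure_singleton]
      filter_upwards [hne] with t ht1 ht
      rw [uIoc_of_le (by norm_num)] at ht
      have hlt : t < 1 / 2 := lt_of_le_of_ne ht.2 ht1
      have hev : segmentConcat x y c =ᶠ[𝓝 t] fun s => x + (2 * s) • (y - x) := by
        filter_upwards [gt_mem_nhds hlt] with s hs
        exact segmentConcat_of_le hs.le
      have hder : HasDerivAt (fun s : ℝ => x + (2 * s) • (y - x)) ((2 * 1 : ℝ) • (y - x)) t :=
        (((hasDerivAt_id t).const_mul 2).smul_const (y - x)).const_add x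
      have hz : x + (2 * t) • (y - x) ∈ segment ℝ x y := by
        rw [segment_eq_image']
        exact ⟨2 * t, ⟨by linarith [ht.1], by linarith⟩, rfl⟩
      rw [hev.deriv_eq, hev.self_of_nhds, hder.deriv, norm_mul, norm_norm, norm_smul,
        norm_sub_rev y x, Real.norm_of_nonneg (Real.sqrt_nonneg _), mul_one, Real.norm_two]
      refine mul_le_mul_of_nonneg_right ?_ (by positivity)
      exact Real.sqrt_le_iff.2 ⟨hk, max_le (hqk _ hz) (sq_nonneg k)⟩
    have := intervalIntegral.norm_integral_le_of_norm_le_const_ae hb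
    refine this.trans (le_of_eq ?_)
    norm_num
    ring
  rw [agmonLength, ← intervalIntegral.integral_add_adjacent_intervals hI1 hI2, e2]
  linarith

theorem agmonDist_le_add (hq : ContinuousOn q (closure Ω)) (hseg : segment ℝ x y ⊆ Ω) {k : ℝ}
    (hk : 0 ≤ k) (hqk : ∀ z ∈ segment ℝ x y, q z ^ 2 - E ≤ k ^ 2) :
    agmonDist Ω q E x x' ≤ agmonDist Ω q E y x' + k * ‖x - y‖ := by
  by_cases hne : {l | ∃ c, IsPiecewiseC1Path Ω y x' c ∧ l = agmonLength q E c}.Nonempty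
  · rw [← sub_le_iff_le_add]
    refine le_csInf hne ?_
    rintro _ ⟨c, hc, rfl⟩
    rw [sub_le_iff_le_add]
    exact (csInf_le bddBelow_agmonLength ⟨_, hc.segmentConcat hseg, rfl⟩).trans
      (agmonLength_segmentConcat_le hq hc hseg hk hqk)
  -- If no path joins `y` to `x'`, none joins `x` to `x'` either, by reversing the segment; both
  -- infima then take the default value `sInf ∅ = 0`.
  · have : agmonDist Ω q E x x' = 0 := by
      have he : {l | ∃ c, IsPiecewiseC1Path Ω x x' c ∧ l = agmonLength q E c} = ∅ := by
        refine Set.eq_empty_iff_forall_notMem.2 ?_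
        rintro _ ⟨c, hc, -⟩
        exact hne ⟨_, _, hc.segmentConcat (segment_symm ℝ x y ▸ hseg), rfl⟩
      rw [agmonDist, he, Real.sInf_empty]
    rw [this]
    exact add_nonneg agmonDist_nonneg (by positivity)

variable {A B : Set (EuclideanSpace ℝ (Fin d))}

theorem bddBelow_agmonDist : BddBelow {l | ∃ x ∈ A, ∃ x' ∈ B, l = agmonDist Ω q E x x'} :=
  ⟨0, by rintro _ ⟨x, -, x', -, rfl⟩; exact agmonDist_nonneg⟩

theorem agmonSetDist_nonneg : 0 ≤ agmonSetDist Ω q E A B :=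
  Real.sInf_nonneg (by rintro _ ⟨x, -, x', -, rfl⟩; exact agmonDist_nonneg)

theorem agmonSetDist_le_singleton (hB : B.Nonempty) (hx : x ∈ A) :
    agmonSetDist Ω q E A B ≤ agmonSetDist Ω q E {x} B := by
  obtain ⟨b, hb⟩ := hB
  refine csInf_le_csInf bddBelow_agmonDist ⟨_, x, rfl, b, hb, rfl⟩ ?_
  rintro _ ⟨_, rfl, x', hx', rfl⟩
  exact ⟨_, hx, x', hx', rfl⟩

theorem agmonSetDist_singleton_of_mem (hx : x ∈ B) (hxΩ : x ∈ Ω) :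
    agmonSetDist Ω q E {x} B = 0 :=
  le_antisymm (csInf_le bddBelow_agmonDist ⟨x, rfl, x, hx, (agmonDist_self hxΩ).symm⟩)
    agmonSetDist_nonneg

/-- This is the eikonal inequality `|∇d|² ≤ (q² - E)₊` in integrated form, as needed by the
smoothing lemma. -/
theorem agmonSetDist_singleton_le_add (hB : B.Nonempty) (hq : ContinuousOn q (closure Ω))
    (hseg : segment ℝ x y ⊆ Ω) {k : ℝ} (hk : 0 ≤ k)
    (hqk : ∀ z ∈ segment ℝ x y, q z ^ 2 - E ≤ k ^ 2) :
    agmonSetDist Ω q E {x} B ≤ agmonSetDist Ω q E {y} B + k * ‖x - y‖ := by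
  obtain ⟨b, hb⟩ := hB
  rw [← sub_le_iff_le_add]
  refine le_csInf ⟨_, y, rfl, b, hb, rfl⟩ ?_
  rintro _ ⟨z, hz, x', hx', rfl⟩
  rw [mem_singleton_iff.1 hz, sub_le_iff_le_add, agmonSetDist]
  exact (csInf_le bddBelow_agmonDist ⟨x, mem_singleton x, x', hx', rfl⟩).trans
    (agmonDist_le_add hq hseg hk hqk)

/-- Smooth approximations, on compact sets, of the truncated Agmon distance to `B`. -/
theorem exists_smooth_agmon_weight (hΩ : IsOpen Ω) (hb : Bornology.IsBounded Ω)
    (hq : ContinuousOn q (closure Ω)) (hB : B.Nonempty) {T : ℝ} (hT : 0 ≤ T)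
    {s : Set (EuclideanSpace ℝ (Fin d))} (hs : IsCompact s) (hsΩ : s ⊆ Ω) {ε ε' : ℝ} (hε : 0 < ε)
    (hε' : 0 < ε') :
    ∃ g : EuclideanSpace ℝ (Fin d) → ℝ, ContDiff ℝ ∞ g ∧
      ∀ x ∈ s, |g x - min (agmonSetDist Ω q E {x} B) T| ≤ ε' ∧
        ‖gradient g x‖ ^ 2 ≤ max (q x ^ 2 - E) 0 + ε := by
  refine exists_smooth_approx (f := fun x => min (agmonSetDist Ω q E {x} B) T) (T := T) hΩ hb
    ((hq.pow 2).sub continuousOn_const) (fun x _ => ?_) (fun x y hseg k hk hqk => ?_) hs hsΩ hε hε'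
  · rw [abs_of_nonneg (le_min agmonSetDist_nonneg hT)]
    exact min_le_right _ _
  · have h1 := agmonSetDist_singleton_le_add (B := B) hB hq hseg hk hqk
    have h2 := agmonSetDist_singleton_le_add (B := B) hB hq (segment_symm ℝ x y ▸ hseg) hk
      (segment_symm ℝ x y ▸ hqk)
    rw [norm_sub_rev] at h2
    refine (abs_min_sub_min_le_max _ _ _ _).trans ?_
    rw [sub_self, abs_zero, max_eq_left (abs_nonneg _), abs_le]
    constructor <;> linarith

end AgmonDistance

end Grushin

/-! ### Cauchy–Schwarz and limits in `L²`. -/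

theorem MeasureTheory.integrable_and_enorm_integral_le {α E₁ E₂ : Type*} [MeasurableSpace α]
    [NormedAddCommGroup E₁] [NormedAddCommGroup E₂] {μ : Measure α} {a : α → E₁} {b : α → E₂}
    {F : α → ℝ} (ha : MemLp a 2 μ) (hb : MemLp b 2 μ) (hF : AEStronglyMeasurable F μ) (k : NNReal)
    (h : ∀ᵐ x ∂μ, ‖F x‖ ≤ k * ‖a x‖ * ‖b x‖) :
    Integrable F μ ∧ ‖∫ x, F x ∂μ‖ₑ ≤ k * eLpNorm a 2 μ * eLpNorm b 2 μ := by
  have h1 : eLpNorm F 1 μ ≤ k * eLpNorm a 2 μ * eLpNorm b 2 μ :=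
    (eLpNorm_mono_ae_real h).trans
      (eLpNorm_le_eLpNorm_mul_eLpNorm'_of_norm ha.1 hb.1 (fun u v => (k : ℝ) * ‖u‖ * ‖v‖) k
        (ae_of_all _ fun x => by simp))
  refine ⟨memLp_one_iff_integrable.1 ⟨hF, h1.trans_lt ?_⟩, ?_⟩
  · exact ENNReal.mul_lt_top (ENNReal.mul_lt_top ENNReal.coe_lt_top ha.2) hb.2
  · refine (enorm_integral_le_lintegral_enorm F).trans ?_
    rwa [← eLpNorm_one_eq_lintegral_enorm]

theorem MeasureTheory.MemLp.eLpNorm_two_eq {α E₁ : Type*} [MeasurableSpace α]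
    [NormedAddCommGroup E₁] {μ : Measure α} {a : α → E₁} (ha : MemLp a 2 μ) :
    eLpNorm a 2 μ = ENNReal.ofReal (Real.sqrt (∫ x, ‖a x‖ ^ 2 ∂μ)) := by
  rw [ha.eLpNorm_eq_integral_rpow_norm two_ne_zero ENNReal.ofNat_ne_top, Real.sqrt_eq_rpow]
  norm_num

theorem ENNReal.tendsto_mul_mul_add_zero {a : ℕ → ENNReal} (ha : Tendsto a atTop (𝓝 0))
    {K b : ENNReal} (hK : K ≠ ⊤) (hb : b ≠ ⊤) :
    Tendsto (fun n => K * (a n * (a n + b))) atTop (𝓝 0) := by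
  have h1 : Tendsto (fun n => a n + b) atTop (𝓝 (0 + b)) := ha.add tendsto_const_nhds
  rw [zero_add] at h1
  have h2 : Tendsto (fun n => a n * (a n + b)) atTop (𝓝 (0 * b)) :=
    ENNReal.Tendsto.mul ha (Or.inr hb) h1 (Or.inr ENNReal.zero_ne_top)
  have h3 := ENNReal.Tendsto.const_mul h2 (Or.inr hK)
  simpa using h3

/-- Squares of functions converging in `L²` have converging integrals. -/
theorem MeasureTheory.tendsto_integral_sq_of_tendsto_eLpNorm {α : Type*} [MeasurableSpace α]
    {μ : Measure α} {f : ℕ → α → ℝ} {g : α → ℝ} (hf : ∀ n, MemLp (f n) 2 μ) (hg : MemLp g 2 μ)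
    (h : Tendsto (fun n => eLpNorm (fun x => f n x - g x) 2 μ) atTop (𝓝 0)) :
    Tendsto (fun n => ∫ x, f n x ^ 2 ∂μ) atTop (𝓝 (∫ x, g x ^ 2 ∂μ)) := by
  rw [tendsto_iff_edist_tendsto_0]
  have hfin : 2 * eLpNorm g 2 μ ≠ ⊤ := ENNReal.mul_ne_top ENNReal.ofNat_ne_top hg.2.ne
  refine tendsto_of_tendsto_of_tendsto_of_le_of_le tendsto_const_nhds
    (ENNReal.tendsto_mul_mul_add_zero h ENNReal.one_ne_top hfin) (fun _ => bot_le) fun n => ?_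
  have hs : MemLp (fun x => f n x - g x) 2 μ := (hf n).sub hg
  have ha : MemLp (fun x => f n x + g x) 2 μ := (hf n).add hg
  have hle : eLpNorm (fun x => f n x + g x) 2 μ ≤
      eLpNorm (fun x => f n x - g x) 2 μ + 2 * eLpNorm g 2 μ := by
    have e : (fun x => f n x + g x) = (fun x => f n x - g x) + (g + g) := by
      funext x; simp
    rw [e, two_mul]
    refine (eLpNorm_add_le hs.1 (hg.1.add hg.1) one_le_two).trans ?_
    gcongr
    exact eLpNorm_add_le hg.1 hg.1 one_le_two
  beta_reduce
  rw [edist_eq_enorm_sub, ← integral_sub (hf n).integrable_sq hg.integrable_sq, one_mul]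
  refine (integrable_and_enorm_integral_le hs ha (F := fun x => f n x ^ 2 - g x ^ 2)
    ((hf n).integrable_sq.sub hg.integrable_sq).aestronglyMeasurable 1 (ae_of_all _ fun x => ?_)).2.trans ?_
  · rw [NNReal.coe_one, one_mul, ← norm_mul]
    exact le_of_eq (congrArg _ (by ring))
  · rw [ENNReal.coe_one, one_mul]
    gcongr

namespace Grushin

/-! ### Continuity of the singular quadratic form on `H¹₀`. -/

section Form

variable {d : ℕ} {Ω : Set (EuclideanSpace ℝ (Fin d))} {w : EuclideanSpace ℝ (Fin d) → ℝ}

theorem IsTestFunction.setIntegral_eq {F : EuclideanSpace ℝ (Fin d) → ℝ}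
    (hw : IsTestFunction Ω w) (hF : ∀ x ∉ tsupport w, F x = 0) :
    ∫ x in Ω, F x = ∫ x, F x :=
  setIntegral_eq_integral_of_forall_compl_eq_zero fun x hx =>
    hF x fun h => hx (hw.tsupport_subset h)

theorem gradient_eq_zero_of_notMem_tsupport {x : EuclideanSpace ℝ (Fin d)}
    (hx : x ∉ tsupport w) : gradient w x = 0 :=
  image_eq_zero_of_notMem_tsupport fun h => hx (tsupport_gradient_subset h)

theorem IsTestFunction.memLp (hw : IsTestFunction Ω w) : MemLp w 2 (volume.restrict Ω) :=
  (hw.contDiff.continuous.memLp_of_hasCompactSupport hw.hasCompactSupport).restrict Ω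

theorem IsTestFunction.memLp_gradient (hw : IsTestFunction Ω w) :
    MemLp (gradient w) 2 (volume.restrict Ω) :=
  ((continuous_gradient hw.contDiff_one).memLp_of_hasCompactSupport
    (hasCompactSupport_gradient hw.hasCompactSupport)).restrict Ω

theorem IsTestFunction.sub {v : EuclideanSpace ℝ (Fin d) → ℝ} (hv : IsTestFunction Ω v)
    (hw : IsTestFunction Ω w) : IsTestFunction Ω (fun x => v x - w x) :=
  ⟨hv.contDiff.sub hw.contDiff, hv.hasCompactSupport.sub hw.hasCompactSupport,
    (tsupport_sub v w).trans (union_subset hv.tsupport_subset hw.tsupport_subset)⟩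

theorem IsTestFunction.gradient_sub {v : EuclideanSpace ℝ (Fin d) → ℝ} (hv : IsTestFunction Ω v)
    (hw : IsTestFunction Ω w) (x : EuclideanSpace ℝ (Fin d)) :
    gradient (fun x => v x - w x) x = gradient v x - gradient w x := by
  rw [gradient, fderiv_fun_sub (hv.contDiff_one.differentiable one_ne_zero x)
    (hw.contDiff_one.differentiable one_ne_zero x), map_sub]
  rfl

/-- The Hardy inequality with integrals over `Ω`. -/
theorem hardy_setIntegral (hΩ : IsSmoothBoundedDomain Ω)
    (h0 : (0 : EuclideanSpace ℝ (Fin d)) ∈ frontier Ω ∨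
      (3 ≤ d ∧ (0 : EuclideanSpace ℝ (Fin d)) ∈ Ω)) {κ : ℝ} (hκ : κ < hardyConst Ω) :
    ∃ C, ∀ w, IsTestFunction Ω w → MemLp (fun x => w x / ‖x‖) 2 (volume.restrict Ω) ∧
      κ * ∫ x in Ω, (w x / ‖x‖) ^ 2 ≤
        (∫ x in Ω, ‖gradient w x‖ ^ 2) + C * ∫ x in Ω, w x ^ 2 := by
  obtain ⟨C, hC⟩ := hardy hΩ h0 hκ
  refine ⟨C, fun w hw => ?_⟩
  obtain ⟨hI, hle⟩ := hC w hw
  have hm : AEStronglyMeasurable (fun x => w x / ‖x‖) (volume.restrict Ω) :=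
    (hw.contDiff.continuous.measurable.div measurable_norm).aestronglyMeasurable
  simp_rw [← div_pow] at hI hle
  refine ⟨(memLp_two_iff_integrable_sq hm).2 hI.restrict, ?_⟩
  rw [hw.setIntegral_eq fun x hx => by simp [image_eq_zero_of_notMem_tsupport hx],
    hw.setIntegral_eq fun x hx => by simp [gradient_eq_zero_of_notMem_tsupport hx],
    hw.setIntegral_eq fun x hx => by simp [image_eq_zero_of_notMem_tsupport hx]]
  exact hle

theorem exists_eLpNorm_div_norm_le_of_isTestFunction (hΩ : IsSmoothBoundedDomain Ω)
    (h0 : (0 : EuclideanSpace ℝ (Fin d)) ∈ frontier Ω ∨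
      (3 ≤ d ∧ (0 : EuclideanSpace ℝ (Fin d)) ∈ Ω)) :
    ∃ C : NNReal, ∀ w, IsTestFunction Ω w →
      eLpNorm (fun x => w x / ‖x‖) 2 (volume.restrict Ω) ≤
        C * (eLpNorm (gradient w) 2 (volume.restrict Ω) + eLpNorm w 2 (volume.restrict Ω)) := by
  -- Any positive `κ` below the Hardy constant would do here: only boundedness of `w/|x|` in terms
  -- of the `H¹` norm is needed.
  set κ := hardyConst Ω / 2 with hκ
  have hH := hardyConst_pos h0
  have hκ0 : 0 < κ := by positivity
  obtain ⟨C, hC⟩ := hardy_setIntegral hΩ h0 (κ := κ) (by linarith)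
  refine ⟨Real.toNNReal (Real.sqrt ((1 + |C|) / κ)), fun w hw => ?_⟩
  obtain ⟨hm, hle⟩ := hC w hw
  rw [hm.eLpNorm_two_eq, hw.memLp_gradient.eLpNorm_two_eq, hw.memLp.eLpNorm_two_eq,
    ← ENNReal.ofReal_add (Real.sqrt_nonneg _) (Real.sqrt_nonneg _), ← ENNReal.ofReal,
    ← ENNReal.ofReal_mul (Real.sqrt_nonneg _)]
  refine ENNReal.ofReal_le_ofReal ?_
  simp_rw [Real.norm_eq_abs, sq_abs]
  have ha : 0 ≤ ∫ x in Ω, ‖gradient w x‖ ^ 2 := integral_nonneg fun x => by positivity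
  have hb : 0 ≤ ∫ x in Ω, w x ^ 2 := integral_nonneg fun x => by positivity
  generalize (∫ x in Ω, ‖gradient w x‖ ^ 2) = a at *
  generalize (∫ x in Ω, w x ^ 2) = b at *
  calc _ ≤ Real.sqrt ((1 + |C|) / κ * (a + b)) := by
        refine Real.sqrt_le_sqrt ?_
        rw [div_mul_eq_mul_div, le_div_iff₀ hκ0, mul_comm]
        nlinarith [mul_nonneg (abs_nonneg C) ha, mul_le_mul_of_nonneg_right (le_abs_self C) hb]
    _ = Real.sqrt ((1 + |C|) / κ) * Real.sqrt (a + b) := Real.sqrt_mul (by positivity) _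
    _ ≤ _ := by
        gcongr
        refine Real.sqrt_le_iff.2 ⟨by positivity, ?_⟩
        nlinarith [Real.sq_sqrt ha, Real.sq_sqrt hb,
          mul_nonneg (Real.sqrt_nonneg a) (Real.sqrt_nonneg b)]

/-- The bound passes from test functions to `H¹₀` by Fatou along an almost everywhere convergent
subsequence. -/
theorem IsH10WithGradient.eLpNorm_div_norm_le {C : NNReal}
    (hC : ∀ w, IsTestFunction Ω w → eLpNorm (fun x => w x / ‖x‖) 2 (volume.restrict Ω) ≤
        C * (eLpNorm (gradient w) 2 (volume.restrict Ω) + eLpNorm w 2 (volume.restrict Ω)))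
    {f : EuclideanSpace ℝ (Fin d) → ℝ} {g : EuclideanSpace ℝ (Fin d) → EuclideanSpace ℝ (Fin d)}
    (hf : IsH10WithGradient Ω f g) :
    eLpNorm (fun x => f x / ‖x‖) 2 (volume.restrict Ω) ≤
      C * (eLpNorm g 2 (volume.restrict Ω) + eLpNorm f 2 (volume.restrict Ω)) := by
  obtain ⟨φ, hφ, h1, h2⟩ := hf.exists_approx
  obtain ⟨ns, hns, hae⟩ := (tendstoInMeasure_of_tendsto_eLpNorm two_ne_zero
    (fun n => (hφ n).memLp.1) hf.memLp.1 h1).exists_seq_tendsto_ae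
  have hlim : ∀ᵐ x ∂volume.restrict Ω,
      Tendsto (fun k => φ (ns k) x / ‖x‖) atTop (𝓝 (f x / ‖x‖)) := by
    filter_upwards [hae] with x hx
    exact hx.div_const _
  refine (Lp.eLpNorm_lim_le_liminf_eLpNorm (fun k => ((hφ (ns k)).contDiff.continuous.measurable.div
    measurable_norm).aestronglyMeasurable) _ hlim).trans ?_
  have hub : ∀ n, eLpNorm (fun x => φ n x / ‖x‖) 2 (volume.restrict Ω) ≤
      C * ((eLpNorm (fun x => gradient (φ n) x - g x) 2 (volume.restrict Ω) +
        eLpNorm g 2 (volume.restrict Ω)) +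
        (eLpNorm (fun x => φ n x - f x) 2 (volume.restrict Ω) +
        eLpNorm f 2 (volume.restrict Ω))) := by
    intro n
    refine (hC _ (hφ n)).trans ?_
    gcongr
    · have e : gradient (φ n) = (fun x => gradient (φ n) x - g x) + g := by ext1 x; simp
      conv_lhs => rw [e]
      exact eLpNorm_add_le ((hφ n).memLp_gradient.sub hf.memLp_gradient).1 hf.memLp_gradient.1
        one_le_two
    · have e : φ n = (fun x => φ n x - f x) + f := by ext1 x; simp
      conv_lhs => rw [e]
      exact eLpNorm_add_le ((hφ n).memLp.sub hf.memLp).1 hf.memLp.1 one_le_two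
  have ht : Tendsto (fun n => (C : ENNReal) *
      ((eLpNorm (fun x => gradient (φ n) x - g x) 2 (volume.restrict Ω) +
        eLpNorm g 2 (volume.restrict Ω)) +
        (eLpNorm (fun x => φ n x - f x) 2 (volume.restrict Ω) +
        eLpNorm f 2 (volume.restrict Ω)))) atTop
      (𝓝 (C * ((0 + eLpNorm g 2 (volume.restrict Ω)) + (0 + eLpNorm f 2 (volume.restrict Ω))))) :=
    ENNReal.Tendsto.const_mul ((h2.add tendsto_const_nhds).add (h1.add tendsto_const_nhds))
      (Or.inr ENNReal.coe_ne_top)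
  rw [zero_add, zero_add] at ht
  refine le_trans (liminf_le_liminf (Eventually.of_forall fun k => hub (ns k))) ?_
  exact ((ht.comp hns.tendsto_atTop).liminf_eq).le

theorem IsTestFunction.isH10WithGradient (hw : IsTestFunction Ω w) :
    IsH10WithGradient Ω w (gradient w) :=
  ⟨hw.memLp, hw.memLp_gradient, fun _ => w, fun _ => hw, by simp, by simp⟩

theorem IsH10WithGradient.testFunction_sub
    {f : EuclideanSpace ℝ (Fin d) → ℝ} {g : EuclideanSpace ℝ (Fin d) → EuclideanSpace ℝ (Fin d)}
    (hf : IsH10WithGradient Ω f g) (hw : IsTestFunction Ω w) :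
    IsH10WithGradient Ω (fun x => w x - f x) (fun x => gradient w x - g x) := by
  obtain ⟨φ, hφ, h1, h2⟩ := hf.exists_approx
  refine ⟨hw.memLp.sub hf.memLp, hw.memLp_gradient.sub hf.memLp_gradient,
    fun n x => w x - φ n x, fun n => hw.sub (hφ n), ?_, ?_⟩
  · refine h1.congr fun n => ?_
    rw [← eLpNorm_neg]
    congr 1
    ext1 x
    simp
  · refine h2.congr fun n => ?_
    rw [← eLpNorm_neg]
    congr 1
    ext1 x
    simp only [Pi.neg_apply, hw.gradient_sub (hφ n)]
    abel

/-- Continuity of the bilinear form of a Schrödinger operator whose potential is the sum of a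
bounded function and of a multiple of `|x|⁻²`. -/
theorem exists_form_bound (hΩ : IsSmoothBoundedDomain Ω)
    (h0 : (0 : EuclideanSpace ℝ (Fin d)) ∈ frontier Ω ∨
      (3 ≤ d ∧ (0 : EuclideanSpace ℝ (Fin d)) ∈ Ω))
    {b : EuclideanSpace ℝ (Fin d) → ℝ} (hb : AEStronglyMeasurable b (volume.restrict Ω)) {B : NNReal}
    (hB : ∀ x ∈ Ω, |b x| ≤ B) (c : ℝ) :
    ∃ K : NNReal, ∀ f g θ, IsH10WithGradient Ω f g → IsTestFunction Ω θ →
      Integrable (fun x => inner ℝ (g x) (gradient θ x) + (b x + c / ‖x‖ ^ 2) * f x * θ x)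
        (volume.restrict Ω) ∧
      ‖∫ x in Ω, (inner ℝ (g x) (gradient θ x) + (b x + c / ‖x‖ ^ 2) * f x * θ x)‖ₑ ≤
        K * ((eLpNorm g 2 (volume.restrict Ω) + eLpNorm f 2 (volume.restrict Ω)) *
          (eLpNorm (gradient θ) 2 (volume.restrict Ω) + eLpNorm θ 2 (volume.restrict Ω))) := by
  obtain ⟨C, hC⟩ := exists_eLpNorm_div_norm_le_of_isTestFunction hΩ h0
  -- The three terms bound the gradient, bounded and singular parts; in the last, Hardy is used once
  -- for each of `f` and `θ`.
  refine ⟨1 + B + ‖c‖₊ * C * C, fun f g θ hf hθ => ?_⟩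
  have hfd : MemLp (fun x => f x / ‖x‖) 2 (volume.restrict Ω) := by
    refine ⟨(hf.memLp.1.aemeasurable.div measurable_norm.aemeasurable).aestronglyMeasurable,
      (hf.eLpNorm_div_norm_le hC).trans_lt ?_⟩
    exact ENNReal.mul_lt_top ENNReal.coe_lt_top
      (ENNReal.add_lt_top.2 ⟨hf.memLp_gradient.2, hf.memLp.2⟩)
  have hθd : MemLp (fun x => θ x / ‖x‖) 2 (volume.restrict Ω) := by
    refine ⟨(hθ.contDiff.continuous.measurable.div measurable_norm).aestronglyMeasurable,
      (hC θ hθ).trans_lt ?_⟩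
    exact ENNReal.mul_lt_top ENNReal.coe_lt_top
      (ENNReal.add_lt_top.2 ⟨hθ.memLp_gradient.2, hθ.memLp.2⟩)
  obtain ⟨I1, E1⟩ := integrable_and_enorm_integral_le hf.memLp_gradient hθ.memLp_gradient
    (F := fun x => inner ℝ (g x) (gradient θ x))
    (hf.memLp_gradient.1.inner hθ.memLp_gradient.1) 1
    (ae_of_all _ fun x => by simpa using norm_inner_le_norm (𝕜 := ℝ) (g x) (gradient θ x))
  obtain ⟨I2, E2⟩ := integrable_and_enorm_integral_le hf.memLp hθ.memLp
    (F := fun x => b x * f x * θ x) ((hb.mul hf.memLp.1).mul hθ.memLp.1) B (by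
      filter_upwards [ae_restrict_mem hΩ.isOpen.measurableSet] with x hx
      rw [norm_mul, norm_mul]
      gcongr
      exact hB x hx)
  obtain ⟨I3, E3⟩ := integrable_and_enorm_integral_le hfd hθd
    (F := fun x => c * (f x / ‖x‖ * (θ x / ‖x‖))) ((hfd.1.mul hθd.1).const_mul c) ‖c‖₊
    (ae_of_all _ fun x => by rw [norm_mul, norm_mul, coe_nnnorm, mul_assoc])
  have e : (fun x => inner ℝ (g x) (gradient θ x) + (b x + c / ‖x‖ ^ 2) * f x * θ x) =
      fun x => inner ℝ (g x) (gradient θ x) + b x * f x * θ x +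
        c * (f x / ‖x‖ * (θ x / ‖x‖)) := by
    funext x; ring
  rw [e]
  refine ⟨(I1.add I2).add I3, ?_⟩
  rw [integral_add (by exact I1.add I2) I3, integral_add I1 I2]
  refine (enorm_add_le _ _).trans ((add_le_add ((enorm_add_le _ _).trans (add_le_add E1 E2)) E3).trans ?_)
  have hf' := hf.eLpNorm_div_norm_le hC
  have hθ' := hC θ hθ
  generalize eLpNorm g 2 (volume.restrict Ω) = n1 at *
  generalize eLpNorm f 2 (volume.restrict Ω) = n2 at *
  generalize eLpNorm (gradient θ) 2 (volume.restrict Ω) = m1 at *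
  generalize eLpNorm θ 2 (volume.restrict Ω) = m2 at *
  push_cast
  rw [add_mul, add_mul]
  refine add_le_add (add_le_add ?_ ?_) ?_
  · rw [mul_assoc]
    exact mul_le_mul' le_rfl (mul_le_mul' le_self_add le_self_add)
  · rw [mul_assoc]
    exact mul_le_mul' le_rfl (mul_le_mul' le_add_self le_add_self)
  · calc _ ≤ (‖c‖₊ : ENNReal) * (C * (n1 + n2)) * (C * (m1 + m2)) := by gcongr
      _ = _ := by ring

end Form


/-! ### Exponential weights and the conjugated energy. -/

section Weighted

variable {d : ℕ} {Ω : Set (EuclideanSpace ℝ (Fin d))} {φ Ψ : EuclideanSpace ℝ (Fin d) → ℝ}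

theorem gradient_exp_mul {x : EuclideanSpace ℝ (Fin d)} (hΨ : DifferentiableAt ℝ Ψ x)
    (hφ : DifferentiableAt ℝ φ x) :
    gradient (fun y => Real.exp (Ψ y) * φ y) x =
      Real.exp (Ψ x) • (gradient φ x + φ x • gradient Ψ x) := by
  refine ext_inner_right ℝ fun v => ?_
  rw [inner_gradient_left, inner_smul_left, inner_add_left, inner_smul_left, inner_gradient_left,
    inner_gradient_left, fderiv_fun_mul hΨ.exp hφ, fderiv_exp hΨ]
  simp
  ring

theorem gradient_const_mul {x : EuclideanSpace ℝ (Fin d)} (c : ℝ) (hΨ : DifferentiableAt ℝ Ψ x) :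
    gradient (fun y => c * Ψ y) x = c • gradient Ψ x := by
  refine ext_inner_right ℝ fun v => ?_
  rw [inner_gradient_left, inner_smul_left, inner_gradient_left, fderiv_const_mul hΨ]
  simp

theorem IsTestFunction.exp_mul (hφ : IsTestFunction Ω φ) (hΨ : ContDiff ℝ ∞ Ψ) :
    IsTestFunction Ω (fun x => Real.exp (Ψ x) * φ x) :=
  ⟨hΨ.exp.mul hφ.contDiff, hφ.hasCompactSupport.mul_left,
    (tsupport_mul_subset_right (f := fun x => Real.exp (Ψ x))).trans hφ.tsupport_subset⟩

/-- The constant depends on `Ψ` only through its bounds on the support of `φ`, hence is uniform over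
weights that change with `φ`. -/
theorem IsTestFunction.eLpNorm_exp_mul_le (hφ : IsTestFunction Ω φ) (hΨ : ContDiff ℝ ∞ Ψ)
    {M Γ : ℝ} (hM : ∀ x ∈ tsupport φ, Ψ x ≤ M) (hΓ0 : 0 ≤ Γ)
    (hΓ : ∀ x ∈ tsupport φ, ‖gradient Ψ x‖ ≤ Γ) :
    eLpNorm (gradient fun x => Real.exp (Ψ x) * φ x) 2 (volume.restrict Ω) +
      eLpNorm (fun x => Real.exp (Ψ x) * φ x) 2 (volume.restrict Ω) ≤
      2 * ENNReal.ofReal (Real.exp M * (1 + Γ)) *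
        (eLpNorm (gradient φ) 2 (volume.restrict Ω) + eLpNorm φ 2 (volume.restrict Ω)) := by
  have h1 : eLpNorm (fun x => Real.exp (Ψ x) * φ x) 2 (volume.restrict Ω) ≤
      ENNReal.ofReal (Real.exp M * (1 + Γ)) * eLpNorm φ 2 (volume.restrict Ω) := by
    refine eLpNorm_le_mul_eLpNorm_of_ae_le_mul (ae_of_all _ fun x => ?_) 2
    by_cases hx : x ∈ tsupport φ
    · rw [norm_mul, Real.norm_of_nonneg (Real.exp_pos _).le]
      gcongr
      nlinarith [Real.exp_le_exp.2 (hM x hx), Real.exp_pos M]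
    · simp [image_eq_zero_of_notMem_tsupport hx]
  have h2 : eLpNorm (gradient fun x => Real.exp (Ψ x) * φ x) 2 (volume.restrict Ω) ≤
      ENNReal.ofReal (Real.exp M * (1 + Γ)) *
        eLpNorm (fun x => ‖gradient φ x‖ + ‖φ x‖) 2 (volume.restrict Ω) := by
    refine eLpNorm_le_mul_eLpNorm_of_ae_le_mul (ae_of_all _ fun x => ?_) 2
    rw [gradient_exp_mul (hΨ.differentiable (by simp) x) (hφ.contDiff.differentiable (by simp) x)]
    by_cases hx : x ∈ tsupport φ
    · rw [norm_smul, Real.norm_of_nonneg (Real.exp_pos _).le, mul_assoc,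
        Real.norm_of_nonneg (add_nonneg (norm_nonneg _) (norm_nonneg _))]
      refine mul_le_mul (Real.exp_le_exp.2 (hM x hx)) ?_ (norm_nonneg _) (Real.exp_pos _).le
      refine (norm_add_le _ _).trans ?_
      rw [norm_smul]
      have := mul_le_mul_of_nonneg_left (hΓ x hx) (norm_nonneg (φ x))
      nlinarith [norm_nonneg (φ x), norm_nonneg (gradient φ x),
        mul_nonneg hΓ0 (norm_nonneg (gradient φ x))]
    · simp only [image_eq_zero_of_notMem_tsupport hx, gradient_eq_zero_of_notMem_tsupport hx]
      simp
  have h3 : eLpNorm (fun x => ‖gradient φ x‖ + ‖φ x‖) 2 (volume.restrict Ω) ≤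
      eLpNorm (gradient φ) 2 (volume.restrict Ω) + eLpNorm φ 2 (volume.restrict Ω) := by
    refine (eLpNorm_add_le hφ.memLp_gradient.1.norm hφ.memLp.1.norm one_le_two).trans ?_
    rw [eLpNorm_norm, eLpNorm_norm]
  calc _ ≤ ENNReal.ofReal (Real.exp M * (1 + Γ)) *
        (eLpNorm (gradient φ) 2 (volume.restrict Ω) + eLpNorm φ 2 (volume.restrict Ω)) +
        ENNReal.ofReal (Real.exp M * (1 + Γ)) *
        (eLpNorm (gradient φ) 2 (volume.restrict Ω) + eLpNorm φ 2 (volume.restrict Ω)) :=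
        add_le_add (h2.trans (by gcongr)) (h1.trans (by gcongr; exact le_add_self))
    _ = _ := by ring

/-- The Agmon energy estimate for test functions. -/
theorem IsTestFunction.agmon_energy_le (hφ : IsTestFunction Ω φ) (hΨ : ContDiff ℝ ∞ Ψ)
    (hΩ : MeasurableSet Ω) {κ C : ℝ}
    (hC : ∀ w, IsTestFunction Ω w → MemLp (fun x => w x / ‖x‖) 2 (volume.restrict Ω) ∧
      κ * ∫ x in Ω, (w x / ‖x‖) ^ 2 ≤ (∫ x in Ω, ‖gradient w x‖ ^ 2) + C * ∫ x in Ω, w x ^ 2)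
    {b : EuclideanSpace ℝ (Fin d) → ℝ} (hb : AEStronglyMeasurable b (volume.restrict Ω)) {B : ℝ}
    (hB : ∀ x ∈ Ω, |b x| ≤ B) :
    Integrable (fun x => (b x - ‖gradient Ψ x‖ ^ 2 - C) * (Real.exp (Ψ x) * φ x) ^ 2)
      (volume.restrict Ω) ∧
    ∫ x in Ω, (b x - ‖gradient Ψ x‖ ^ 2 - C) * (Real.exp (Ψ x) * φ x) ^ 2 ≤
      ∫ x in Ω, (inner ℝ (gradient φ x) (gradient (fun y => Real.exp (2 * Ψ y) * φ y) x) +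
        (b x + -κ / ‖x‖ ^ 2) * φ x * (Real.exp (2 * Ψ x) * φ x)) := by
  have hw := hφ.exp_mul hΨ
  set w := fun x => Real.exp (Ψ x) * φ x with hwdef
  obtain ⟨hm, hle⟩ := hC w hw
  have hΨd : ∀ x, DifferentiableAt ℝ Ψ x := fun x => hΨ.differentiable (by simp) x
  have hφd : ∀ x, DifferentiableAt ℝ φ x := fun x => hφ.contDiff.differentiable (by simp) x
  have I1 : Integrable (fun x => ‖gradient w x‖ ^ 2) (volume.restrict Ω) :=
    hw.memLp_gradient.integrable_norm_pow two_ne_zero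
  have I2 : Integrable (fun x => ‖gradient Ψ x‖ ^ 2 * w x ^ 2) (volume.restrict Ω) :=
    (Continuous.integrable_mul_of_continuousAt (hw.contDiff.continuous.pow 2)
      hw.hasCompactSupport_sq fun x _ => ((continuous_gradient (hΨ.of_le (by simp))).norm.pow
        2).continuousAt).restrict
  have I3 : Integrable (fun x => b x * w x ^ 2) (volume.restrict Ω) :=
    hw.memLp.integrable_sq.bdd_mul hb (c := B) (by
      filter_upwards [ae_restrict_mem hΩ] with x hx using hB x hx)
  have I4 : Integrable (fun x => (w x / ‖x‖) ^ 2) (volume.restrict Ω) := hm.integrable_sq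
  have I5 : Integrable (fun x => w x ^ 2) (volume.restrict Ω) := hw.memLp.integrable_sq
  -- The first-order cross terms cancel: `∇φ · ∇(e^{2Ψ} φ) = |∇w|² - |∇Ψ|² w²`. Hardy for `w` then
  -- absorbs `κ (w/|x|)²`.
  have eR : ∀ x, inner ℝ (gradient φ x) (gradient (fun y => Real.exp (2 * Ψ y) * φ y) x) +
      (b x + -κ / ‖x‖ ^ 2) * φ x * (Real.exp (2 * Ψ x) * φ x) =
      ‖gradient w x‖ ^ 2 - ‖gradient Ψ x‖ ^ 2 * w x ^ 2 + b x * w x ^ 2 -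
        κ * (w x / ‖x‖) ^ 2 := by
    intro x
    rw [gradient_exp_mul (Ψ := fun y => 2 * Ψ y) ((hΨd x).const_mul 2) (hφd x),
      gradient_const_mul 2 (hΨd x), hwdef, gradient_exp_mul (hΨd x) (hφd x), norm_smul, mul_pow,
      norm_add_sq_real, norm_smul, inner_smul_right, inner_add_right, inner_smul_right,
      inner_smul_right, inner_smul_right, real_inner_self_eq_norm_sq, two_mul, Real.exp_add]
    simp only [Real.norm_eq_abs, mul_pow, sq_abs]
    ring
  have eL : ∀ x, (b x - ‖gradient Ψ x‖ ^ 2 - C) * w x ^ 2 =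
      b x * w x ^ 2 - ‖gradient Ψ x‖ ^ 2 * w x ^ 2 - C * w x ^ 2 := fun x => by ring
  change Integrable (fun x => (b x - ‖gradient Ψ x‖ ^ 2 - C) * w x ^ 2) _ ∧
    ∫ x in Ω, (b x - ‖gradient Ψ x‖ ^ 2 - C) * w x ^ 2 ≤ _
  simp_rw [eR, eL]
  refine ⟨(I3.sub I2).sub (I5.const_mul C), ?_⟩
  rw [integral_sub (by exact I3.sub I2) (I5.const_mul C), integral_sub I3 I2,
    integral_sub (by exact (I1.sub I2).add I3) (I4.const_mul κ),
    integral_add (by exact I1.sub I2) I3, integral_sub I1 I2, integral_const_mul,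
    integral_const_mul]
  linarith

end Weighted


/-! ### Agmon decay at a fixed parameter. -/

section Decay

variable {d : ℕ} {Ω : Set (EuclideanSpace ℝ (Fin d))} {q : EuclideanSpace ℝ (Fin d) → ℝ}

/-- Agmon decay of an eigenfunction for a fixed, large enough, value of the parameter. -/
theorem IsNormalizedEigenfunction.integral_sq_le (hΩ : IsSmoothBoundedDomain Ω)
    (h0 : (0 : EuclideanSpace ℝ (Fin d)) ∈ frontier Ω ∨
      (3 ≤ d ∧ (0 : EuclideanSpace ℝ (Fin d)) ∈ Ω)) (hq : ContinuousOn q (closure Ω))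
    {ν C : ℝ} (hC : ∀ w, IsTestFunction Ω w → MemLp (fun x => w x / ‖x‖) 2 (volume.restrict Ω) ∧
      (hardyConst Ω - ν ^ 2) * ∫ x in Ω, (w x / ‖x‖) ^ 2 ≤
        (∫ x in Ω, ‖gradient w x‖ ^ 2) + C * ∫ x in Ω, w x ^ 2)
    {S : Set (EuclideanSpace ℝ (Fin d))} (hS_meas : MeasurableSet S) (hS : S ⊆ Ω) {δ : ℝ}
    (hδ : 0 < δ) (hF : (wellSet Ω q δ).Nonempty) (hSF : ∀ x ∈ wellSet Ω q δ, x ∉ S)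
    {ξ lam : ℝ} (hξ : 0 < ξ) (hlam : |lam| + |C| ≤ ξ ^ 2 * δ / 4)
    {u : EuclideanSpace ℝ (Fin d) → ℝ} (hu : IsNormalizedEigenfunction Ω q ν ξ lam u) :
    ∫ x in S, u x ^ 2 ≤
      4 * Real.exp 4 * Real.exp (-2 * ξ * agmonSetDist Ω q δ S (wellSet Ω q δ)) := by
  obtain ⟨⟨-, g, hg, hweak⟩, hnorm⟩ := hu
  set T := agmonSetDist Ω q δ S (wellSet Ω q δ) with hT
  have hT0 : 0 ≤ T := agmonSetDist_nonneg
  obtain ⟨Q, hQ⟩ := hΩ.isBounded.isCompact_closure.exists_bound_of_continuousOn (hq.pow 2)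
  have hQ' : ∀ x ∈ Ω, q x ^ 2 ≤ |Q| := fun x hx =>
    (le_abs_self _).trans ((hQ x (subset_closure hx)).trans (le_abs_self _))
  -- Putting the eigenvalue into the bounded potential makes the weak equation homogeneous.
  set b : EuclideanSpace ℝ (Fin d) → ℝ := fun x => ξ ^ 2 * q x ^ 2 - lam with hbdef
  have hqm : ContinuousOn q Ω := hq.mono subset_closure
  have hb : AEStronglyMeasurable b (volume.restrict Ω) :=
    ((continuousOn_const.mul (hqm.pow 2)).sub continuousOn_const).aestronglyMeasurable
      hΩ.isOpen.measurableSet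
  obtain ⟨B, hB⟩ : ∃ B : NNReal, ∀ x ∈ Ω, |b x| ≤ B := by
    refine ⟨⟨ξ ^ 2 * |Q| + |lam|, by positivity⟩, fun x hx => ?_⟩
    refine (abs_sub _ _).trans ?_
    rw [abs_mul, abs_of_nonneg (sq_nonneg ξ), abs_of_nonneg (sq_nonneg (q x))]
    exact add_le_add (mul_le_mul_of_nonneg_left (hQ' x hx) (sq_nonneg ξ)) le_rfl
  obtain ⟨K, hK⟩ := exists_form_bound hΩ h0 hb hB (-(hardyConst Ω - ν ^ 2))
  have hweak0 : ∀ θ, IsTestFunction Ω θ → ∫ x in Ω, (inner ℝ (g x) (gradient θ x) +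
      (b x + -(hardyConst Ω - ν ^ 2) / ‖x‖ ^ 2) * u x * θ x) = 0 := by
    intro θ hθ
    obtain ⟨hI, -⟩ := hK u g θ hg hθ
    have hI2 : Integrable (fun x => lam * u x * θ x) (volume.restrict Ω) := by
      simp_rw [mul_assoc]
      exact (hg.memLp.integrable_mul hθ.memLp).const_mul lam
    have e : ∀ x, inner ℝ (g x) (gradient θ x) +
        (ξ ^ 2 * q x ^ 2 + (ν ^ 2 - hardyConst Ω) / ‖x‖ ^ 2) * u x * θ x =
        (inner ℝ (g x) (gradient θ x) +
        (b x + -(hardyConst Ω - ν ^ 2) / ‖x‖ ^ 2) * u x * θ x) + lam * u x * θ x := by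
      intro x; simp only [hbdef]; ring
    have := hweak θ hθ
    simp_rw [e] at this
    rw [integral_add hI hI2] at this
    linarith
  obtain ⟨φ, hφ, h1, h2⟩ := hg.exists_approx
  -- After scaling by `ξ`, the error `1/ξ` becomes `1`, and the loss `δ/2` in the squared gradient
  -- leaves a gap `ξ² δ/2` outside the well.
  choose G hGs hG using fun n => exists_smooth_agmon_weight (E := δ) (ε := δ / 2) (ε' := 1 / ξ)
    hΩ.isOpen hΩ.isBounded hq hF hT0 (hφ n).hasCompactSupport.isCompact (hφ n).tsupport_subset
    (by positivity) (by positivity)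
  set Ψ : ℕ → EuclideanSpace ℝ (Fin d) → ℝ := fun n x => ξ * G n x with hΨdef
  have hΨs : ∀ n, ContDiff ℝ ∞ (Ψ n) := fun n => contDiff_const.mul (hGs n)
  have hΨ1 : ∀ n, ∀ x ∈ tsupport (φ n),
      |Ψ n x - ξ * min (agmonSetDist Ω q δ {x} (wellSet Ω q δ)) T| ≤ 1 := by
    intro n x hx
    rw [hΨdef, ← mul_sub, abs_mul, abs_of_pos hξ]
    calc _ ≤ ξ * (1 / ξ) := mul_le_mul_of_nonneg_left (hG n x hx).1 hξ.le
      _ = 1 := by field_simp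
  have hΨ2 : ∀ n, ∀ x ∈ tsupport (φ n),
      ‖gradient (Ψ n) x‖ ^ 2 ≤ ξ ^ 2 * (max (q x ^ 2 - δ) 0 + δ / 2) := by
    intro n x hx
    rw [hΨdef, gradient_const_mul ξ ((hGs n).differentiable (by simp) x), norm_smul, mul_pow,
      Real.norm_eq_abs, sq_abs]
    exact mul_le_mul_of_nonneg_left (hG n x hx).2 (sq_nonneg ξ)
  have hΨle : ∀ n, ∀ x ∈ tsupport (φ n), Ψ n x ≤ ξ * T + 1 := by
    intro n x hx
    have h3 := (abs_le.1 (hΨ1 n x hx)).2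
    have h4 := mul_le_mul_of_nonneg_left
      (min_le_right (agmonSetDist Ω q δ {x} (wellSet Ω q δ)) T) hξ.le
    linarith
  set θ : ℕ → EuclideanSpace ℝ (Fin d) → ℝ := fun n x => Real.exp (2 * Ψ n x) * φ n x with hθdef
  have hθ : ∀ n, IsTestFunction Ω (θ n) := fun n =>
    (hφ n).exp_mul (Ψ := fun x => 2 * Ψ n x) (contDiff_const.mul (hΨs n))
  set e : ℕ → ℝ := fun n => ∫ x in Ω, (inner ℝ (gradient (φ n) x) (gradient (θ n) x) +
    (b x + -(hardyConst Ω - ν ^ 2) / ‖x‖ ^ 2) * φ n x * θ n x) with hedef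
  set a : ℕ → ENNReal := fun n => eLpNorm (fun x => gradient (φ n) x - g x) 2 (volume.restrict Ω) +
    eLpNorm (fun x => φ n x - u x) 2 (volume.restrict Ω) with hadef
  have ha : Tendsto a atTop (𝓝 0) := by simpa using h2.add h1
  have he : Tendsto e atTop (𝓝 0) := by
    -- The factor `2` comes from the weight `2Ψ`; the gradient norm is bounded through `t ≤ 1 + t²`.
    set Γ := 2 * (1 + ξ ^ 2 * (|Q| + δ))
    set P := 2 * ENNReal.ofReal (Real.exp (2 * (ξ * T + 1)) * (1 + Γ))
    have hθb : ∀ n, eLpNorm (gradient (θ n)) 2 (volume.restrict Ω) +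
        eLpNorm (θ n) 2 (volume.restrict Ω) ≤
        P * (a n + (eLpNorm g 2 (volume.restrict Ω) + eLpNorm u 2 (volume.restrict Ω))) := by
      intro n
      refine ((hφ n).eLpNorm_exp_mul_le (Ψ := fun x => 2 * Ψ n x) (M := 2 * (ξ * T + 1)) (Γ := Γ)
        (contDiff_const.mul (hΨs n)) (fun x hx => ?_) (by positivity) fun x hx => ?_).trans ?_
      · linarith [hΨle n x hx]
      · rw [gradient_const_mul 2 ((hΨs n).differentiable (by simp) x), norm_smul, Real.norm_two]
        refine mul_le_mul_of_nonneg_left ?_ zero_le_two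
        have h3 : max (q x ^ 2 - δ) 0 + δ / 2 ≤ |Q| + δ := by
          have := hQ' x ((hφ n).tsupport_subset hx)
          have : max (q x ^ 2 - δ) 0 ≤ |Q| := max_le (by linarith) (abs_nonneg Q)
          linarith
        have h4 := mul_le_mul_of_nonneg_left h3 (sq_nonneg ξ)
        nlinarith [hΨ2 n x hx, sq_nonneg (‖gradient (Ψ n) x‖ - 1)]
      · refine mul_le_mul' le_rfl ?_
        have h3 : eLpNorm (gradient (φ n)) 2 (volume.restrict Ω) ≤
            eLpNorm (fun x => gradient (φ n) x - g x) 2 (volume.restrict Ω) +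
            eLpNorm g 2 (volume.restrict Ω) := by
          have e : gradient (φ n) = (fun x => gradient (φ n) x - g x) + g := by ext1 x; simp
          conv_lhs => rw [e]
          exact eLpNorm_add_le ((hφ n).memLp_gradient.sub hg.memLp_gradient).1
            hg.memLp_gradient.1 one_le_two
        have h4 : eLpNorm (φ n) 2 (volume.restrict Ω) ≤
            eLpNorm (fun x => φ n x - u x) 2 (volume.restrict Ω) +
            eLpNorm u 2 (volume.restrict Ω) := by
          have e : φ n = (fun x => φ n x - u x) + u := by ext1 x; simp
          conv_lhs => rw [e]
          exact eLpNorm_add_le ((hφ n).memLp.sub hg.memLp).1 hg.memLp.1 one_le_two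
        refine (add_le_add h3 h4).trans (le_of_eq ?_)
        simp only [hadef]
        ring
    have hfin : eLpNorm g 2 (volume.restrict Ω) + eLpNorm u 2 (volume.restrict Ω) ≠ ⊤ :=
      ENNReal.add_ne_top.2 ⟨hg.memLp_gradient.2.ne, hg.memLp.2.ne⟩
    have hPfin : (K : ENNReal) * P ≠ ⊤ := ENNReal.mul_ne_top ENNReal.coe_ne_top
      (ENNReal.mul_ne_top ENNReal.ofNat_ne_top ENNReal.ofReal_ne_top)
    rw [tendsto_iff_edist_tendsto_0]
    refine tendsto_of_tendsto_of_tendsto_of_le_of_le tendsto_const_nhds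
      (ENNReal.tendsto_mul_mul_add_zero ha hPfin hfin) (fun _ => bot_le) fun n => ?_
    -- Subtracting the weak equation for `u` tested on `θ n` shows that `e n` is the form at `(φ n -
    -- u, θ n)`: one factor tends to `0` in `H¹`, the other stays bounded.
    have hd : e n = ∫ x in Ω, (inner ℝ (gradient (φ n) x - g x) (gradient (θ n) x) +
        (b x + -(hardyConst Ω - ν ^ 2) / ‖x‖ ^ 2) * (φ n x - u x) * θ n x) := by
      rw [← sub_zero (e n), ← hweak0 (θ n) (hθ n), hedef,
        ← integral_sub (hK _ _ _ (hφ n).isH10WithGradient (hθ n)).1 (hK _ _ _ hg (hθ n)).1]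
      refine integral_congr_ae (ae_of_all _ fun x => ?_)
      simp only [inner_sub_left]
      ring
    beta_reduce
    rw [edist_zero_right, hd]
    refine (hK _ _ _ (hg.testFunction_sub (hφ n)) (hθ n)).2.trans ?_
    calc _ ≤ (K : ENNReal) * (a n * (P * (a n + (eLpNorm g 2 (volume.restrict Ω) +
          eLpNorm u 2 (volume.restrict Ω))))) := by
          gcongr
          exact hθb n
      _ = _ := by ring
  have hlower : ∀ n, ξ ^ 2 * δ / 4 * Real.exp (2 * (ξ * T - 1)) * (∫ x in S, φ n x ^ 2) -
      ξ ^ 2 * δ * Real.exp 2 * (∫ x in Ω, φ n x ^ 2) ≤ e n := by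
    intro n
    obtain ⟨hI, hle⟩ := (hφ n).agmon_energy_le (hΨs n) hΩ.isOpen.measurableSet hC hb hB
    refine le_trans ?_ hle
    have hsq : Integrable (fun x => φ n x ^ 2) (volume.restrict Ω) := (hφ n).memLp.integrable_sq
    have eS : ∫ x in S, φ n x ^ 2 = ∫ x in Ω, S.indicator (fun x => φ n x ^ 2) x := by
      rw [setIntegral_indicator hS_meas, inter_eq_self_of_subset_right hS]
    rw [eS, ← integral_const_mul, ← integral_const_mul,
      ← integral_sub ((hsq.indicator hS_meas).const_mul _) (hsq.const_mul _)]
    refine setIntegral_mono_on (((hsq.indicator hS_meas).const_mul _).sub (hsq.const_mul _)) hI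
      hΩ.isOpen.measurableSet fun x hxΩ => ?_
    by_cases hx : x ∈ tsupport (φ n)
    swap
    · have : φ n x = 0 := image_eq_zero_of_notMem_tsupport hx
      by_cases hxS : x ∈ S <;> simp [this, hxS]
    have hg2 := hΨ2 n x hx
    have hl1 := le_abs_self lam
    have hl2 := le_abs_self C
    have hξδ : 0 < ξ ^ 2 * δ := by positivity
    have hφ2 : 0 ≤ φ n x ^ 2 := sq_nonneg _
    have hexp : Real.exp (Ψ n x) ^ 2 = Real.exp (2 * Ψ n x) := by
      rw [two_mul, Real.exp_add, sq]
    rw [mul_pow, hexp]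
    by_cases hxF : x ∈ wellSet Ω q δ
    · rw [indicator_of_notMem (hSF x hxF), max_eq_right (by linarith [hxF.2])] at *
      have hΨx := hΨ1 n x hx
      rw [agmonSetDist_singleton_of_mem hxF hxΩ, min_eq_left hT0, mul_zero, sub_zero] at hΨx
      have h3 : Real.exp (2 * Ψ n x) ≤ Real.exp 2 :=
        Real.exp_le_exp.2 (by linarith [(abs_le.1 hΨx).2])
      have h4 : -(ξ ^ 2 * δ) ≤ b x - ‖gradient (Ψ n) x‖ ^ 2 - C := by
        simp only [hbdef]
        have : 0 ≤ ξ ^ 2 * q x ^ 2 := by positivity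
        nlinarith
      calc _ = -(ξ ^ 2 * δ) * (Real.exp 2 * φ n x ^ 2) := by ring
        _ ≤ -(ξ ^ 2 * δ) * (Real.exp (2 * Ψ n x) * φ n x ^ 2) := by
            refine mul_le_mul_of_nonpos_left ?_ (by linarith)
            gcongr
        _ ≤ _ := mul_le_mul_of_nonneg_right h4 (by positivity)
    · have hqδ : δ < q x ^ 2 := by
        by_contra! h
        exact hxF ⟨hxΩ, h⟩
      rw [max_eq_left (by linarith)] at hg2
      -- Of the gap `ξ² δ/2`, half pays for `lam` and `C`.
      have h4 : ξ ^ 2 * δ / 4 ≤ b x - ‖gradient (Ψ n) x‖ ^ 2 - C := by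
        simp only [hbdef]
        nlinarith
      have h5 : 0 ≤ ξ ^ 2 * δ * Real.exp 2 * φ n x ^ 2 := by positivity
      by_cases hxS : x ∈ S
      · rw [indicator_of_mem hxS]
        have hΨx := hΨ1 n x hx
        -- On `S` the truncation at `T` is active, so the weight is within `1` of its maximal value
        -- `ξ T`.
        rw [min_eq_right (agmonSetDist_le_singleton hF hxS)] at hΨx
        have h3 : Real.exp (2 * (ξ * T - 1)) ≤ Real.exp (2 * Ψ n x) :=
          Real.exp_le_exp.2 (by linarith [(abs_le.1 hΨx).1])
        calc _ ≤ ξ ^ 2 * δ / 4 * (Real.exp (2 * (ξ * T - 1)) * φ n x ^ 2) := by linarith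
          _ ≤ (b x - ‖gradient (Ψ n) x‖ ^ 2 - C) * (Real.exp (2 * Ψ n x) * φ n x ^ 2) := by
              gcongr
              linarith
      · rw [indicator_of_notMem hxS]
        have : 0 ≤ (b x - ‖gradient (Ψ n) x‖ ^ 2 - C) * (Real.exp (2 * Ψ n x) * φ n x ^ 2) :=
          mul_nonneg (by linarith) (by positivity)
        linarith
  have hSle : volume.restrict S ≤ volume.restrict Ω := Measure.restrict_mono hS le_rfl
  have hlimΩ := tendsto_integral_sq_of_tendsto_eLpNorm (fun n => (hφ n).memLp) hg.memLp h1
  have hlimS := tendsto_integral_sq_of_tendsto_eLpNorm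
    (fun n => (hφ n).memLp.mono_measure hSle) (hg.memLp.mono_measure hSle)
    (tendsto_of_tendsto_of_tendsto_of_le_of_le tendsto_const_nhds h1 (fun _ => bot_le)
      fun n => eLpNorm_mono_measure _ hSle)
  have hfinal := le_of_tendsto_of_tendsto' ((hlimS.const_mul _).sub (hlimΩ.const_mul _)) he hlower
  rw [hnorm, mul_one] at hfinal
  have h3 : Real.exp (2 * (ξ * T - 1)) * (∫ x in S, u x ^ 2) ≤ 4 * Real.exp 2 := by
    have hξδ : 0 < ξ ^ 2 * δ := by positivity
    refine le_of_mul_le_mul_left ?_ hξδ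
    linarith
  have h4 : Real.exp (-2 * ξ * T) * Real.exp 2 * Real.exp (2 * (ξ * T - 1)) = 1 := by
    rw [← Real.exp_add, ← Real.exp_add, show -2 * ξ * T + 2 + 2 * (ξ * T - 1) = 0 by ring,
      Real.exp_zero]
  calc ∫ x in S, u x ^ 2 = Real.exp (-2 * ξ * T) * Real.exp 2 *
        (Real.exp (2 * (ξ * T - 1)) * ∫ x in S, u x ^ 2) := by rw [← mul_assoc, h4, one_mul]
    _ ≤ Real.exp (-2 * ξ * T) * Real.exp 2 * (4 * Real.exp 2) :=
        mul_le_mul_of_nonneg_left h3 (by positivity)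
    _ = 4 * (Real.exp 2 * Real.exp 2) * Real.exp (-2 * ξ * T) := by ring
    _ = _ := by rw [← Real.exp_add]; norm_num

end Decay

end Grushin

/-! ### Choice of `δ₀` and `ξ₀`, and conclusion. -/

theorem mainTheorem6 {d : ℕ} (Ω : Set (EuclideanSpace ℝ (Fin d)))
    (hΩ : Grushin.IsSmoothBoundedDomain Ω)
    (h0 : (0 : EuclideanSpace ℝ (Fin d)) ∈ frontier Ω ∨
      (3 ≤ d ∧ (0 : EuclideanSpace ℝ (Fin d)) ∈ Ω))
    (ν : ℝ) (hν : 0 < ν)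
    (q : EuclideanSpace ℝ (Fin d) → ℝ) (hq : ContinuousOn q (closure Ω))
    (hq0 : q 0 = 0) (hq_ne : ∀ x ∈ closure Ω, x ≠ 0 → q x ≠ 0)
    (lam : ℝ → ℝ) (u : ℝ → EuclideanSpace ℝ (Fin d) → ℝ)
    (hu : ∀ ξ : ℝ, 0 < ξ → Grushin.IsNormalizedEigenfunction Ω q ν ξ (lam ξ) (u ξ))
    (hlam : Asymptotics.IsLittleO atTop lam fun ξ : ℝ => ξ ^ 2)
    (S : Set (EuclideanSpace ℝ (Fin d))) (hS_meas : MeasurableSet S) (hS : S ⊆ Ω)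
    (hS0 : (0 : EuclideanSpace ℝ (Fin d)) ∉ closure S) :
    ∃ δ₀ : ℝ, 0 < δ₀ ∧ ∀ δ : ℝ, 0 < δ → δ < δ₀ →
      Grushin.wellSet Ω q δ ∩ closure S = ∅ ∧
      ∃ ξ₀ : ℝ, 0 < ξ₀ ∧ ∃ C : ℝ, 0 < C ∧ ∀ ξ : ℝ, ξ₀ ≤ ξ →
        (∫ x in S, u ξ x ^ 2) ≤
          C * Real.exp (-2 * ξ * (1 - δ) *
            Grushin.agmonSetDist Ω q δ S (Grushin.wellSet Ω q δ)) := by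
  have hScl : closure S ⊆ closure Ω := closure_mono hS
  have hScomp : IsCompact (closure S) := (hΩ.isBounded.subset hS).isCompact_closure
  obtain ⟨m, hm, hmS⟩ : ∃ m : ℝ, 0 < m ∧ ∀ x ∈ closure S, m ≤ q x ^ 2 := by
    rcases (closure S).eq_empty_or_nonempty with he | hne
    · exact ⟨1, one_pos, by simp [he]⟩
    · obtain ⟨x, hx, hmin⟩ := hScomp.exists_isMinOn hne ((hq.mono hScl).pow 2)
      refine ⟨q x ^ 2, ?_, fun y hy => hmin hy⟩
      have : q x ≠ 0 := hq_ne x (hScl hx) fun h => hS0 (h ▸ hx)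
      positivity
  have h0cl : (0 : EuclideanSpace ℝ (Fin d)) ∈ closure Ω :=
    h0.elim (fun h => frontier_subset_closure h) fun h => subset_closure h.2
  obtain ⟨C, hC⟩ := Grushin.hardy_setIntegral hΩ h0
    (show Grushin.hardyConst Ω - ν ^ 2 < Grushin.hardyConst Ω by
      linarith [pow_pos hν 2])
  refine ⟨min m 1, lt_min hm one_pos, fun δ hδ hδm => ⟨?_, ?_⟩⟩
  · refine Set.eq_empty_iff_forall_notMem.2 fun x hx => ?_
    have h1 := hmS x hx.2
    have h2 : q x ^ 2 ≤ δ := hx.1.2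
    have h3 := hδm.trans_le (min_le_left _ _)
    linarith
  -- The origin may lie outside `Ω`, but `q → 0` there along `Ω`. Nonemptiness keeps the distance to
  -- the well from being the default `sInf ∅`.
  have hF : (Grushin.wellSet Ω q δ).Nonempty := by
    have hlim : Tendsto (fun x => q x ^ 2) (𝓝[Ω] 0) (𝓝 (q 0 ^ 2)) :=
      ((hq 0 h0cl).mono subset_closure).pow 2
    rw [hq0] at hlim
    have := mem_closure_iff_nhdsWithin_neBot.1 h0cl
    obtain ⟨x, hx1, hx2⟩ := ((hlim.eventually (gt_mem_nhds (show (0 : ℝ) ^ 2 < δ by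
      simpa using hδ))).and self_mem_nhdsWithin).exists
    exact ⟨x, hx2, hx1.le⟩
  have hSF : ∀ x ∈ Grushin.wellSet Ω q δ, x ∉ S := by
    intro x hx hxS
    have h1 := hmS x (subset_closure hxS)
    have h2 : q x ^ 2 ≤ δ := hx.2
    have h3 := hδm.trans_le (min_le_left _ _)
    linarith
  have hev : ∀ᶠ ξ : ℝ in atTop, |lam ξ| + |C| ≤ ξ ^ 2 * δ / 4 := by
    have h2 : Tendsto (fun ξ : ℝ => ξ ^ 2) atTop atTop := tendsto_pow_atTop two_ne_zero
    -- Each of `|lam ξ|` and `|C|` is given half of the budget `ξ² δ/4`.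
    filter_upwards [hlam.bound (show 0 < δ / 8 by positivity),
      h2.eventually_ge_atTop (8 * |C| / δ)] with ξ hξ1 hξ2
    rw [div_le_iff₀ hδ] at hξ2
    rw [Real.norm_eq_abs, Real.norm_of_nonneg (sq_nonneg ξ)] at hξ1
    linarith
  obtain ⟨ξ₁, hξ₁⟩ := eventually_atTop.1 hev
  refine ⟨max ξ₁ 1, by positivity, 4 * Real.exp 4, by positivity, fun ξ hξ => ?_⟩
  have hξ0 : 0 < ξ := one_pos.trans_le ((le_max_right _ _).trans hξ)
  refine ((hu ξ hξ0).integral_sq_le hΩ h0 hq hC hS_meas hS hδ hF hSF hξ0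
    (hξ₁ ξ ((le_max_left _ _).trans hξ))).trans ?_
  refine mul_le_mul_of_nonneg_left (Real.exp_le_exp.2 ?_) (by positivity)
  have hd : 0 ≤ Grushin.agmonSetDist Ω q δ S (Grushin.wellSet Ω q δ) :=
    Grushin.agmonSetDist_nonneg
  nlinarith [mul_nonneg (mul_nonneg hξ0.le hδ.le) hd]
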